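/- Assume $\mathsf{CH}$ (that is, $2^{\aleph_0}=\aleph_1$), $2^{\omega_2}=\omega_3$, and $\Box_{\omega_2}$: there is a sequence $\langle c_\alpha : \alpha<\omega_3,\ \alpha \text{ limit}\rangle$ such that each $c_\alpha$ is a club subset of $\alpha$ of order type at most $\omega_2$, and $c_\alpha\cap\beta=c_\beta$ whenever $\beta<\alpha$ is a limit point of $c_\alpha$. Let $H(\omega_3)$ be the collection of all sets whose transitive closure has cardinality less than $\omega_3$, and let $[H(\omega_3)]^{\omega_1}$ be the collection of its subsets of cardinality $\omega_1$. Then there exist stationary subsets $\mathcal Y$ and $\mathcal Y^+$ of $[H(\omega_3)]^{\omega_1}$ (each meets every subfamily of $[H(\omega_3)]^{\omega_1}$ that is cofinal under $\subseteq$ and closed under unions of nonempty $\subseteq$-chains of length at most $\omega_1$) satisfying: (1) for all $M\in\mathcal Y$, $M$ is an elementary submodel of $(H(\omega_3),\in)$, $|M|=\omega_1$, and $M^\omega\subseteq M$ (every function from $\omega$ to $M$ is an element of $M$); (2) for all $M,N\in\mathcal Y$, $M\cap N\in\mathcal Y$; (3) $\mathcal Y^+\subseteq\mathcal Y$; (4)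 for all $M\in\mathcal Y$ the set $M\cap\omega_2$ is an ordinal, and for all $M\in\mathcal Y$ and $N\in\mathcal Y^+$, if $M\cap\omega_2<N\cap\omega_2$ (as ordinals) then $M\cap N\in N$. -/

import Mathlib

open Cardinal Ordinal

universe u

namespace MitchellModels

/-- The transitive closure of `x`: all `y` with `y ∈ y₁ ∈ ⋯ ∈ yₙ ∈ x` for some `n ≥ 0`.
Bounding by the level of the von Neumann hierarchy given by the rank of `x` only serves to obtain a
set, see `mem_trcl`. -/
noncomputable def trcl (x : ZFSet.{u}) : ZFSet.{u} :=
  ZFSet.sep (fun y => Relation.TransGen (· ∈ ·) y x) (ZFSet.vonNeumann (ZFSet.rank x))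

theorem rank_lt_of_transGen {y x : ZFSet.{u}} (h : Relation.TransGen (· ∈ ·) y x) :
    ZFSet.rank y < ZFSet.rank x := by
  induction h with
  | single h => exact ZFSet.rank_lt_of_mem h
  | tail _ h ih => exact ih.trans (ZFSet.rank_lt_of_mem h)

theorem mem_trcl {y x : ZFSet.{u}} : y ∈ trcl x ↔ Relation.TransGen (· ∈ ·) y x := by
  rw [trcl, ZFSet.mem_sep, ZFSet.mem_vonNeumann]
  exact ⟨fun h => h.2, fun h => ⟨rank_lt_of_transGen h, h⟩⟩

/-- `H(κ)`: the sets whose transitive closure has cardinality less than `κ`. -/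
def H (κ : Cardinal.{u}) : Set ZFSet.{u} :=
  {x | (trcl x).card < κ}

/-- The relation symbols of the language of set theory: a single binary symbol. -/
inductive MemRel : ℕ → Type
  | mem : MemRel 2

/-- The first-order language of set theory. -/
def memLang : FirstOrder.Language := ⟨fun _ => Empty, MemRel⟩

/-- A collection of sets, viewed as the structure `(X, ∈)`. -/
instance memStructure (X : Set ZFSet.{u}) : memLang.Structure X where
  funMap := fun f => nomatch f
  RelMap := fun | MemRel.mem => fun v => (v 0 : ZFSet.{u}) ∈ (v 1 : ZFSet.{u})

/-- `M ≺ X`: the set `M` is (the universe of) an elementary substructure of `(X, ∈)`. -/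
def IsElementaryIn (M : ZFSet.{u}) (X : Set ZFSet.{u}) : Prop :=
  ∃ S : memLang.ElementarySubstructure X, Subtype.val '' (S : Set X) = {x | x ∈ M}

/-- `M^ω ⊆ M`: every function from `ω` to `M` is a member of `M`. -/
def IsOmegaClosed (M : ZFSet.{u}) : Prop :=
  ZFSet.funs ZFSet.omega M ⊆ M

/-- `[X]^{ω₁}`: the subsets of `X` of cardinality exactly `ω₁`. -/
def subsetsOmega1 (X : Set ZFSet.{u}) : Set ZFSet.{u} :=
  {M | (∀ x ∈ M, x ∈ X) ∧ M.card = ℵ₁}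

/-- `C` is club in `[X]^{ω₁}`: cofinal under inclusion and closed under unions of nonempty chains
of cardinality at most `ω₁`. -/
structure IsClubOmega1 (X C : Set ZFSet.{u}) : Prop where
  subset : C ⊆ subsetsOmega1 X
  unbounded : ∀ a ∈ subsetsOmega1 X, ∃ b ∈ C, a ⊆ b
  closed : ∀ D : ZFSet.{u}, D.Nonempty → (∀ a ∈ D, a ∈ C) →
    (∀ a ∈ D, ∀ b ∈ D, a ⊆ b ∨ b ⊆ a) → D.card ≤ ℵ₁ → ZFSet.sUnion D ∈ C

/-- `S` is a stationary subset of `[X]^{ω₁}`: it meets every club. -/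
def IsStationaryOmega1 (X S : Set ZFSet.{u}) : Prop :=
  S ⊆ subsetsOmega1 X ∧ ∀ C, IsClubOmega1 X C → (S ∩ C).Nonempty

/-- `β` is a limit point of `C`: `β > 0` and `C ∩ β` is unbounded in `β`. -/
def IsLimitPoint (β : Ordinal.{u}) (C : Set Ordinal.{u}) : Prop :=
  0 < β ∧ ∀ γ < β, ∃ δ ∈ C, γ < δ ∧ δ < β

/-- `C` is a club subset of the ordinal `α`. -/
def IsClubBelow (C : Set Ordinal.{u}) (α : Ordinal.{u}) : Prop :=
  C ⊆ Set.Iio α ∧ IsClub (Subtype.val ⁻¹' C : Set (Set.Iio α))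

/-- `□_{ω₂}`: there is a sequence `⟨c_α : α < ω₃ limit⟩` such that each `c_α` is a club subset of
`α` of order type at most `ω₂`, and `c_α ∩ β = c_β` for every `β < α` which is a limit point of
`c_α`. -/
def SquareOmega2 : Prop :=
  ∃ c : Ordinal.{u} → Set Ordinal.{u}, ∀ α < ω_ 3, Order.IsSuccLimit α →
    IsClubBelow (c α) α ∧ typeLT (c α) ≤ ω_ 2 ∧
      ∀ β < α, IsLimitPoint β (c α) → c α ∩ Set.Iio β = c β

/-- The set `ω₂`, as a von Neumann ordinal. -/
noncomputable def omega2 : ZFSet.{u} :=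
  Ordinal.toZFSet (ω_ 2)

end MitchellModels

open MitchellModels

/-!
Fix a square sequence `c`, functions from `ω₂` onto each `β < ω₃`, and a function from `ω₃` onto
`H(ω₃)`, which exists since `2 ^ ω₂ = ω₃`. The first family consists of the sets `M ⊆ H(ω₃)` of
size `ω₁` with `ω₁ ∈ M` which are closed under a fixed list of operations on `ω`-sequences: Skolem
functions, the formation of the sequence itself as a set, and functions obtained from the fixed
objects. Such sets are closed under intersections, so all but the last clause and stationarity are
direct. The operations are allowed to return up to `ω₁` values, and by `CH` a set of size `ω₁` or
`ω₂` has no more `ω`-sequences than elements, so that there are closed sets of both sizes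
(`exists_closed`).

The second family consists of those `N` for which `c (sup (N ∩ ω₃))` has order type at least
`N ∩ ω₂`. Let `M` be in the first family and `N` in the second, with `δ = M ∩ ω₂ ∈ N`, and put
`P = M ∩ N` and `α = sup (P ∩ ω₃)`. By closure under suprema of `ω`-sequences, the limit points of
`c α` in `P` are unbounded in `α` (`IsRich.exists_isLimitPoint`). For such a limit point `β`,
coherence gives `c β = c α ∩ β`, and the order type of `c β` is in `P ∩ ω₂ ⊆ δ`. Hence `c α` has
order type at most `δ` (`IsRich.index_lt_of_sSup`), and `c α ⊆ P`.
* `α ∈ N` (`IsRich.sSup_inter_mem`). Otherwise, either `α = sup (N ∩ ω₃)`, and `c α` has an element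
  of index `δ` by the choice of `N`, or `α` is a limit point of `c α'`, where `α'` is the least
  ordinal of `N` above `α`. In the latter case `c α = c α' ∩ α`, and the element of `c α'` of index
  `δ` lies in `N`, hence below `α`; if there is none, then `c α' ⊆ N`, and `N` meets `[α, α')`.
* `P ∩ ω₃` is the union of the images of `δ` in `β`, for `β ∈ c α` (`IsRich.mem_inter_iff`). So `P`
  is computed from `α` and `δ` by one of the operations under which `N` is closed.

For the stationarity of the second family, let `C` be a club. There is a function on finite sets
such that sets of size `ω₁` closed under it are in `C` (`IsClubOmega1.exists_finset_fun` and
`IsClubOmega1.mem_of_closed`). Take a set `K` of size `ω₂` which is closed under this function and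
all operations and whose ordinals form an ordinal `d` of cofinality `ω₂`
(`exists_closedUnder_ords_eq_Iio`). Then `c d` has order type `ω₂`. If `N ⊆ K` is closed and, in
addition, closed under the enumeration of `c d` and under passing to the next element of `c d`, then
`sup (N ∩ ω₃)` is a limit point of `c d`, and by coherence `c (sup (N ∩ ω₃))` contains the elements
of `c d` with index in `N ∩ ω₂`.
-/

universe v w

namespace MitchellModels

/-! ### Cardinal arithmetic -/

theorem lift_mk_iUnion_le_of_le {ι : Type v} {α : Type w} {c : Cardinal.{max v w}} (hc : ℵ₀ ≤ c)
    {f : ι → Set α} (hι : Cardinal.lift.{w} #ι ≤ c) (hf : ∀ i, Cardinal.lift.{v} #(f i) ≤ c) :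
    Cardinal.lift.{v} #(⋃ i, f i) ≤ c := by
  refine (mk_iUnion_le_lift f).trans ?_
  exact (mul_le_mul' hι (ciSup_le' hf)).trans (mul_eq_self hc).le

theorem mk_iUnion_le_of_le {ι α : Type v} {c : Cardinal.{v}} (hc : ℵ₀ ≤ c)
    {f : ι → Set α} (hι : #ι ≤ c) (hf : ∀ i, #(f i) ≤ c) : #(⋃ i, f i) ≤ c := by
  simpa using lift_mk_iUnion_le_of_le hc (f := f) (by simpa using hι) (by simpa using hf)

theorem succ_aleph_one : Order.succ (ℵ₁ : Cardinal.{v}) = ℵ_ 2 := by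
  rw [succ_aleph, one_add_one_eq_two]

theorem succ_aleph_two : Order.succ (ℵ_ 2 : Cardinal.{v}) = ℵ_ 3 := by
  rw [succ_aleph, two_add_one_eq_three]

theorem aleph_one_lt_aleph_two : (ℵ₁ : Cardinal.{v}) < ℵ_ 2 := by
  rw [← succ_aleph_one]; exact Order.lt_succ _

theorem isRegular_aleph_two : (ℵ_ 2 : Cardinal.{v}).IsRegular := by
  rw [← succ_aleph_one]; exact isRegular_succ (aleph0_le_aleph _)

theorem isRegular_aleph_three : (ℵ_ 3 : Cardinal.{v}).IsRegular := by
  rw [← succ_aleph_two]; exact isRegular_succ (aleph0_le_aleph _)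

theorem aleph_one_power_aleph0 (hCH : (2 : Cardinal.{v}) ^ (ℵ₀ : Cardinal.{v}) = ℵ₁) :
    (ℵ₁ : Cardinal.{v}) ^ (ℵ₀ : Cardinal.{v}) = ℵ₁ := by
  rw [← hCH, ← power_mul, aleph0_mul_aleph0]

/-- In the initial ordinal of a regular cardinal `c`, sets of size less than `c` are bounded. -/
theorem exists_forall_lt_of_mk_lt {c : Cardinal.{v}} (hc : c.IsRegular) (s : Set c.ord.ToType)
    (hs : #s < c) : ∃ i, ∀ x ∈ s, x < i := by
  by_contra! h
  have : IsCofinal s := fun i => by simpa using h i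
  have := Order.cof_le this
  rw [cof_toType, hc.cof_ord] at this
  exact absurd hs this.not_gt

/-- Sequences in `ω₂` are bounded, so there are `ℵ₂ · ℵ₁ ^ ℵ₀` of them. -/
theorem aleph_two_power_aleph0 (hCH : (2 : Cardinal.{v}) ^ (ℵ₀ : Cardinal.{v}) = ℵ₁) :
    (ℵ_ 2 : Cardinal.{v}) ^ (ℵ₀ : Cardinal.{v}) ≤ ℵ_ 2 := by
  have hA : #((ℵ_ 2 : Cardinal.{v}).ord.ToType) = ℵ_ 2 := by simp
  have key : (⋃ i : (ℵ_ 2 : Cardinal.{v}).ord.ToType,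
      {f : ULift.{v} ℕ → (ℵ_ 2 : Cardinal.{v}).ord.ToType | ∀ n, f n < i}) = Set.univ := by
    refine Set.eq_univ_of_forall fun f => Set.mem_iUnion.2 ?_
    obtain ⟨i, hi⟩ := exists_forall_lt_of_mk_lt isRegular_aleph_two (Set.range f)
      ((mk_range_le.trans (by simp)).trans_lt
        ((aleph0_le_aleph 1).trans_lt aleph_one_lt_aleph_two))
    exact ⟨i, fun n => hi _ ⟨n, rfl⟩⟩
  have h1 : (ℵ_ 2 : Cardinal.{v}) ^ (ℵ₀ : Cardinal.{v})
      = #(ULift.{v} ℕ → (ℵ_ 2 : Cardinal.{v}).ord.ToType) := by simp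
  rw [h1, ← mk_univ, ← key]
  refine mk_iUnion_le_of_le (aleph0_le_aleph 2) (by simp) fun i => ?_
  have hi : #(Set.Iio i) ≤ ℵ₁ := by
    rw [← Order.lt_succ_iff, succ_aleph_one]
    have := mk_Iio_lt i (by simp)
    simpa using this
  calc #{f : ULift.{v} ℕ → (ℵ_ 2 : Cardinal.{v}).ord.ToType | ∀ n, f n < i}
      ≤ #(ULift.{v} ℕ → Set.Iio i) :=
        mk_le_of_injective (f := fun f n => ⟨f.1 n, f.2 n⟩) fun f g h => by
          ext n; simpa using congrArg Subtype.val (congrFun h n)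
    _ ≤ (ℵ₁ : Cardinal.{v}) ^ (ℵ₀ : Cardinal.{v}) := by
        simpa using power_le_power_right hi
    _ = ℵ₁ := aleph_one_power_aleph0 hCH
    _ ≤ ℵ_ 2 := aleph_one_lt_aleph_two.le

theorem mk_le_aleph_one_of_subsingleton {α : Type v} {S : Set α} (h : ∀ a ∈ S, ∀ b ∈ S, a = b) :
    #S ≤ ℵ₁ :=
  (mk_le_one_iff_set_subsingleton.2 fun a ha b hb => h a ha b hb).trans
    (one_le_aleph0.trans (aleph0_le_aleph 1))

theorem mk_union_le_aleph_one {α : Type v} {S T : Set α} (hS : #S ≤ ℵ₁) (hT : #T ≤ ℵ₁) :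
    #(S ∪ T : Set α) ≤ ℵ₁ :=
  (mk_union_le S T).trans (add_le_of_le (aleph0_le_aleph 1) hS hT)

theorem mk_nat_fun_le {α : Type v} {c : Cardinal.{v}} (hc : c ^ (ℵ₀ : Cardinal.{v}) ≤ c)
    (Z : Set α) (hZ : #Z ≤ c) : #(ℕ → Z) ≤ c := by
  have : #(ℕ → Z) = #Z ^ (ℵ₀ : Cardinal.{v}) := by simp
  rw [this]
  exact (power_le_power_right hZ).trans hc

/-! ### Closing off under an operation on sets -/

/-- Iterating `step` along a regular cardinal `c` gives a set of size at most `c`, each small subset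
of which is covered by some stage to which `step` has been applied. -/
theorem exists_closed {α : Type v} {c : Cardinal.{v}} (hc : c.IsRegular) (step : Set α → Set α)
    (hstep : ∀ Z : Set α, #Z ≤ c → #(step Z) ≤ c) :
    ∃ N : Set α, #N ≤ c ∧ ∀ X ⊆ N, #X < c → ∃ Z, X ⊆ Z ∧ Z ⊆ N ∧ #Z ≤ c ∧ step Z ⊆ N := by
  let ι := c.ord.ToType
  have hι : #ι = c := by simp [ι]
  let S : ι → Set α := WellFoundedLT.fix fun i T => ⋃ j : Set.Iio i, T j.1 j.2 ∪ step (T j.1 j.2)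
  have hS : ∀ i, S i = ⋃ j : Set.Iio i, S j.1 ∪ step (S j.1) := fun i => WellFoundedLT.fix_eq _ i
  have hcard : ∀ i, #(S i) ≤ c := fun i => by
    induction i using WellFoundedLT.induction with
    | ind i ih =>
      rw [hS]
      refine mk_iUnion_le_of_le hc.1 ?_ fun j => ?_
      · exact (mk_set_le _).trans hι.le
      · exact (mk_union_le _ _).trans
          (add_le_of_le hc.1 (ih _ j.2) (hstep _ (ih _ j.2)))
  have hmono : ∀ i j, i < j → S i ∪ step (S i) ⊆ S j := fun i j hij x hx => by
    rw [hS j]; exact Set.mem_iUnion.2 ⟨⟨i, hij⟩, hx⟩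
  refine ⟨⋃ i, S i, ?_, fun X hX hXc => ?_⟩
  · exact mk_iUnion_le_of_le hc.1 hι.le hcard
  · have hX' : ∀ x : X, ∃ i, x.1 ∈ S i := fun x => Set.mem_iUnion.1 (hX x.2)
    choose idx hidx using hX'
    obtain ⟨i, hi⟩ := exists_forall_lt_of_mk_lt hc (Set.range idx) (mk_range_le.trans_lt hXc)
    obtain ⟨j, hj⟩ := exists_forall_lt_of_mk_lt hc {i}
      (by rw [mk_singleton]; exact one_lt_aleph0.trans_le hc.1)
    refine ⟨S i, fun x hx => ?_, Set.subset_iUnion _ _, hcard i, ?_⟩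
    · exact hmono _ _ (hi _ ⟨⟨x, hx⟩, rfl⟩) (Or.inl (hidx ⟨x, hx⟩))
    · exact (Set.subset_union_right.trans (hmono i j (hj i rfl))).trans (Set.subset_iUnion _ _)

/-! ### The sets of hereditary cardinality at most `ℵ₂` -/

theorem card_le_aleph_iff {x : ZFSet.{u}} {n : ℕ} :
    x.card ≤ ℵ_ n ↔ #x ≤ ℵ_ (n : Ordinal.{u + 1}) := by
  rw [ZFSet.cardinalMk_coe_sort, ← Cardinal.lift_le.{u + 1}, lift_aleph, Ordinal.lift_natCast]

theorem card_eq_aleph_one_iff {x : ZFSet.{u}} : x.card = ℵ₁ ↔ #x = (ℵ₁ : Cardinal.{u + 1}) := by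
  rw [ZFSet.cardinalMk_coe_sort, ← Cardinal.lift_inj.{u, u + 1}, lift_aleph, Ordinal.lift_one]

theorem mem_H_iff {x : ZFSet.{u}} : x ∈ H (ℵ_ 3) ↔ #(trcl x) ≤ ℵ_ 2 := by
  have := card_le_aleph_iff (x := trcl x) (n := 2)
  rw [Nat.cast_ofNat, Nat.cast_ofNat] at this
  rw [← this, H, Set.mem_ofPred_eq, ← succ_aleph_two, Order.lt_succ_iff]

theorem mem_trcl_self_of_mem {x y : ZFSet.{u}} (h : y ∈ x) : y ∈ trcl x :=
  mem_trcl.2 (.single h)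

theorem mem_trcl_of_mem_of_mem_trcl {x y z : ZFSet.{u}} (hz : z ∈ y) (hy : y ∈ trcl x) :
    z ∈ trcl x :=
  mem_trcl.2 (.head hz (mem_trcl.1 hy))

theorem trcl_subset_of_mem {x y : ZFSet.{u}} (h : y ∈ x) : trcl y ⊆ trcl x := fun _ hz =>
  mem_trcl.2 (.tail (mem_trcl.1 hz) h)

theorem trcl_subset_of_isTransitive {x : ZFSet.{u}} (hx : x.IsTransitive) : trcl x ⊆ x := by
  intro z hz
  induction mem_trcl.1 hz using Relation.TransGen.head_induction_on with
  | single h => exact h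
  | head h h' ih => exact hx _ (ih (mem_trcl.2 h')) h

theorem mk_coe_mono {x y : ZFSet.{u}} (h : x ⊆ y) : #x ≤ #y :=
  mk_le_mk_of_subset (s := {z | z ∈ x}) (t := {z | z ∈ y}) h

theorem mk_le_of_mem_H {x : ZFSet.{u}} (hx : x ∈ H (ℵ_ 3)) : #x ≤ ℵ_ 2 :=
  (mk_coe_mono fun _ => mem_trcl_self_of_mem).trans (mem_H_iff.1 hx)

theorem mem_H_of_forall_mem {x : ZFSet.{u}} (hx : ∀ y ∈ x, y ∈ H (ℵ_ 3)) (hc : #x ≤ ℵ_ 2) :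
    x ∈ H (ℵ_ 3) := by
  rw [mem_H_iff]
  have h : {z | z ∈ trcl x} ⊆ ⋃ y : x, insert y.1 {z | z ∈ trcl y.1} := by
    intro z hz
    rcases Relation.TransGen.tail'_iff.1 (mem_trcl.1 hz) with ⟨y, hzy, hy⟩
    refine Set.mem_iUnion.2 ⟨⟨y, hy⟩, ?_⟩
    rcases Relation.reflTransGen_iff_eq_or_transGen.1 hzy with h | h
    · exact Or.inl h.symm
    · exact Or.inr (mem_trcl.2 h)
  refine (mk_le_mk_of_subset h).trans (mk_iUnion_le_of_le (aleph0_le_aleph 2) hc fun y => ?_)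
  exact mk_insert_le.trans (add_le_of_le (aleph0_le_aleph 2) (mem_H_iff.1 (hx _ y.2))
    (one_le_aleph0.trans (aleph0_le_aleph 2)))

theorem card_le_aleph_two_iff {α : Ordinal.{u}} : α.card ≤ ℵ_ 2 ↔ α < ω_ 3 := by
  rw [← ord_aleph, lt_ord, ← succ_aleph_two, Order.lt_succ_iff]

theorem card_le_aleph_one_iff {α : Ordinal.{u}} : α.card ≤ ℵ₁ ↔ α < ω_ 2 := by
  rw [← ord_aleph, lt_ord, ← succ_aleph_one, Order.lt_succ_iff]

theorem omega_one_lt_omega_two : (ω_ 1 : Ordinal.{u}) < ω_ 2 := by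
  rw [← ord_aleph, ← ord_aleph, ord_lt_ord]; exact aleph_one_lt_aleph_two

theorem omega_two_lt_omega_three : (ω_ 2 : Ordinal.{u}) < ω_ 3 := by
  rw [← ord_aleph, ← ord_aleph, ord_lt_ord, ← succ_aleph_two]; exact Order.lt_succ _

theorem mk_Iio_le_aleph_one {α : Ordinal.{u}} (h : α < ω_ 2) : #(Set.Iio α) ≤ ℵ₁ := by
  rw [Cardinal.mk_Iio_ordinal]
  simpa using Cardinal.lift_le.{u + 1}.2 (card_le_aleph_one_iff.2 h)

theorem mk_Iio_le_aleph_two {α : Ordinal.{u}} (h : α < ω_ 3) : #(Set.Iio α) ≤ ℵ_ 2 := by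
  rw [Cardinal.mk_Iio_ordinal]
  simpa using Cardinal.lift_le.{u + 1}.2 (card_le_aleph_two_iff.2 h)

theorem toZFSet_mem_H_iff {α : Ordinal.{u}} : α.toZFSet ∈ H (ℵ_ 3) ↔ α < ω_ 3 := by
  have h : #α.toZFSet ≤ ℵ_ 2 ↔ α < ω_ 3 := by
    have := card_le_aleph_iff (x := α.toZFSet) (n := 2)
    rw [Nat.cast_ofNat, Nat.cast_ofNat, Ordinal.card_toZFSet] at this
    rw [← this, card_le_aleph_two_iff]
  refine ⟨fun hα => h.1 (mk_le_of_mem_H hα), fun hα => mem_H_iff.2 ?_⟩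
  exact (mk_coe_mono (trcl_subset_of_isTransitive
    (ZFSet.isOrdinal_toZFSet α).isTransitive)).trans (h.2 hα)

theorem singleton_mem_H {x : ZFSet.{u}} (hx : x ∈ H (ℵ_ 3)) : ({x} : ZFSet) ∈ H (ℵ_ 3) := by
  refine mem_H_of_forall_mem (fun y hy => by rwa [ZFSet.mem_singleton.1 hy]) ?_
  have := card_le_aleph_iff (x := ({x} : ZFSet)) (n := 2)
  rw [Nat.cast_ofNat, Nat.cast_ofNat, ZFSet.card_singleton] at this
  exact this.1 (one_le_aleph0.trans (aleph0_le_aleph _))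

theorem doubleton_mem_H {x y : ZFSet.{u}} (hx : x ∈ H (ℵ_ 3)) (hy : y ∈ H (ℵ_ 3)) :
    ({x, y} : ZFSet) ∈ H (ℵ_ 3) := by
  refine mem_H_of_forall_mem (fun z hz => ?_) ?_
  · rcases ZFSet.mem_pair.1 hz with rfl | rfl <;> assumption
  · have := card_le_aleph_iff (x := ({x, y} : ZFSet)) (n := 2)
    rw [Nat.cast_ofNat, Nat.cast_ofNat] at this
    refine this.1 (ZFSet.card_insert_le.trans ?_)
    rw [ZFSet.card_singleton]
    exact add_le_of_le (aleph0_le_aleph _) (one_le_aleph0.trans (aleph0_le_aleph _))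
      (one_le_aleph0.trans (aleph0_le_aleph _))

theorem pair_mem_H {x y : ZFSet.{u}} (hx : x ∈ H (ℵ_ 3)) (hy : y ∈ H (ℵ_ 3)) :
    ZFSet.pair x y ∈ H (ℵ_ 3) :=
  doubleton_mem_H (singleton_mem_H hx) (doubleton_mem_H hx hy)

/-- A set is determined by the isomorphism type of membership on the transitive closure of its
singleton: two sets with injections of these closures into the same type which induce the same
relation and agree at the sets themselves are equal. -/
theorem eq_of_same_code {ι : Type v} {x x' : ZFSet.{u}} (t : trcl {x} → ι) (t' : trcl {x'} → ι)
    (ht : t.Injective) (ht' : t'.Injective)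
    (hE : ∀ i j, (∃ a b, t a = i ∧ t b = j ∧ a.1 ∈ b.1) ↔ ∃ a b, t' a = i ∧ t' b = j ∧ a.1 ∈ b.1)
    (hx : x ∈ trcl {x}) (hx' : x' ∈ trcl {x'}) (h : t ⟨x, hx⟩ = t' ⟨x', hx'⟩) : x = x' := by
  have key : ∀ a : ZFSet.{u}, ∀ (ha : a ∈ trcl {x}) (b : trcl {x'}),
      t ⟨a, ha⟩ = t' b → a = b.1 := by
    intro a
    induction a using ZFSet.inductionOn with
    | h a ih =>
      intro ha b hab
      ext z
      constructor
      · intro hz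
        have hz' : z ∈ trcl {x} := mem_trcl_of_mem_of_mem_trcl hz ha
        obtain ⟨c, d, hc, hd, hcd⟩ :=
          (hE (t ⟨z, hz'⟩) (t ⟨a, ha⟩)).1 ⟨⟨z, hz'⟩, ⟨a, ha⟩, rfl, rfl, hz⟩
        rw [ht' (hd.trans hab)] at hcd
        rwa [ih z hz hz' c hc.symm]
      · intro hz
        have hz' : z ∈ trcl {x'} := mem_trcl_of_mem_of_mem_trcl hz b.2
        obtain ⟨c, d, hc, hd, hcd⟩ := (hE (t' ⟨z, hz'⟩) (t' b)).2 ⟨⟨z, hz'⟩, b, rfl, rfl, hz⟩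
        rw [ht (hd.trans hab.symm)] at hcd
        have hcz : c.1 = z := ih c.1 hcd c.2 ⟨z, hz'⟩ hc
        exact hcz ▸ hcd
  exact key x hx ⟨x', hx'⟩ h

/-- There are at most `2 ^ ω₂` codes, as in `eq_of_same_code`, on the set `ω₂`. -/
theorem mk_H_le (hpow : (2 : Cardinal.{u + 1}) ^ (ℵ_ 2 : Cardinal.{u + 1}) = ℵ_ 3) :
    #(H.{u} (ℵ_ 3)) ≤ ℵ_ 3 := by
  let ι := (ℵ_ 2 : Cardinal.{u + 1}).ord.ToType
  have hι : #ι = ℵ_ 2 := by simp [ι]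
  have hex : ∀ x : H.{u} (ℵ_ 3), Nonempty (trcl {x.1} ↪ ι) := fun x => by
    rw [← Cardinal.le_def, hι]; exact mem_H_iff.1 (singleton_mem_H x.2)
  have hself : ∀ x : ZFSet.{u}, x ∈ trcl {x} := fun x => mem_trcl_self_of_mem (by simp)
  let t := fun x => (hex x).some
  let code : H.{u} (ℵ_ 3) → Set (ι × ι) × ι := fun x =>
    ({p | ∃ a b, t x a = p.1 ∧ t x b = p.2 ∧ a.1 ∈ b.1}, t x ⟨x.1, hself _⟩)
  have hcode : code.Injective := fun x y hxy => by
    have h1 := (Prod.ext_iff.1 hxy).1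
    have h2 := (Prod.ext_iff.1 hxy).2
    refine Subtype.ext (eq_of_same_code (t x) (t y) (t x).injective (t y).injective
      (fun i j => ?_) (hself _) (hself _) h2)
    exact Set.ext_iff.1 h1 (i, j)
  refine (mk_le_of_injective hcode).trans ?_
  have h23 : (ℵ_ 2 : Cardinal.{u + 1}) ≤ ℵ_ 3 := by
    rw [← succ_aleph_two]; exact Order.le_succ _
  simp only [mk_prod, Cardinal.lift_id, mk_set, hι, mul_eq_self (aleph0_le_aleph 2), hpow]
  exact (mul_le_mul' le_rfl h23).trans (mul_eq_self (aleph0_le_aleph 3)).le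

/-! ### Enumerating sets of ordinals -/

/-- The order type of `C ∩ ξ`, as an ordinal of the same universe: the least ordinal above the
indices of all `η ∈ C ∩ ξ`. -/
noncomputable def index (C : Set Ordinal.{u}) : Ordinal.{u} → Ordinal.{u} :=
  WellFoundedLT.fix fun ξ r => sInf {o | ∀ (η : Ordinal.{u}) (h : η < ξ), η ∈ C → r η h < o}

theorem index_eq (C : Set Ordinal.{u}) (ξ : Ordinal.{u}) :
    index C ξ = sInf {o | ∀ η < ξ, η ∈ C → index C η < o} :=
  WellFoundedLT.fix_eq _ ξ

theorem index_le_self (C : Set Ordinal.{u}) (ξ : Ordinal.{u}) : index C ξ ≤ ξ := by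
  induction ξ using WellFoundedLT.induction with
  | ind ξ ih => rw [index_eq]; exact csInf_le' fun η hη _ => (ih η hη).trans_lt hη

theorem index_lt {C : Set Ordinal.{u}} {η ξ : Ordinal.{u}} (hη : η ∈ C) (h : η < ξ) :
    index C η < index C ξ := by
  have : index C ξ ∈ {o | ∀ η < ξ, η ∈ C → index C η < o} := by
    rw [index_eq]
    exact csInf_mem ⟨ξ, fun η hη _ => (index_le_self C η).trans_lt hη⟩
  exact this η h hη

theorem index_injOn (C : Set Ordinal.{u}) : Set.InjOn (index C) C := by
  intro η hη ξ hξ h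
  refine le_antisymm ?_ ?_ <;> by_contra! hlt
  · exact ((index_lt hξ hlt).trans_eq h).false
  · exact ((index_lt hη hlt).trans_eq h.symm).false

theorem index_mono (C : Set Ordinal.{u}) : Monotone (index C) := by
  intro η ξ h
  rw [index_eq C η]
  exact csInf_le' fun ζ hζ hζC => index_lt hζC (hζ.trans_le h)

theorem exists_index_eq {C : Set Ordinal.{u}} {i ξ : Ordinal.{u}} (h : i < index C ξ) :
    ∃ η ∈ C, η < ξ ∧ index C η = i := by
  have h1 : ∃ η, η < ξ ∧ η ∈ C ∧ i ≤ index C η := by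
    by_contra! hcon
    rw [index_eq] at h
    exact notMem_of_lt_csInf' h hcon
  obtain ⟨h2, h3, h4⟩ := csInf_mem (s := {η | η < ξ ∧ η ∈ C ∧ i ≤ index C η}) h1
  refine ⟨_, h3, h2, h4.antisymm' ?_⟩
  rw [index_eq]
  refine csInf_le' fun η hη hηC => ?_
  by_contra! hle
  exact notMem_of_lt_csInf' hη ⟨hη.trans h2, hηC, hle⟩

theorem index_congr {C C' : Set Ordinal.{u}} {ξ : Ordinal.{u}} (h : ∀ η < ξ, η ∈ C ↔ η ∈ C') :
    index C ξ = index C' ξ := by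
  induction ξ using WellFoundedLT.induction with
  | ind ξ ih =>
    rw [index_eq, index_eq C']
    congr 1
    ext o
    refine forall₂_congr fun η hη => ?_
    rw [h η hη, ih η hη fun ζ hζ => h ζ (hζ.trans hη)]

/-- The order type of `C` lives in the next universe, hence the lift. If `index C ξ ≥ o`, then all
ordinals up to `o` are indices, and `C` has order type greater than `o`. -/
theorem index_lt_of_typeLT_le {C : Set Ordinal.{u}} {ξ o : Ordinal.{u}} (hξ : ξ ∈ C)
    (h : typeLT C ≤ Ordinal.lift.{u + 1} o) : index C ξ < o := by
  by_contra! hcon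
  have hex : ∀ i : Set.Iio (Order.succ o), ∃ η : C, index C η = i.1 := fun i => by
    rcases (Order.lt_succ_iff.1 i.2).trans hcon |>.lt_or_eq with hi | hi
    · obtain ⟨η, hη, -, h⟩ := exists_index_eq hi
      exact ⟨⟨η, hη⟩, h⟩
    · exact ⟨⟨ξ, hξ⟩, hi.symm⟩
  choose g hg using hex
  have hmono : StrictMono g := fun i j hij => by
    by_contra! hle
    have := index_mono C (show (g j).1 ≤ (g i).1 from hle)
    rw [hg, hg] at this
    exact absurd hij this.not_gt
  have h1 : typeLT (Set.Iio (Order.succ o)) ≤ typeLT C :=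
    type_le_iff'.2 ⟨(OrderEmbedding.ofStrictMono g hmono).ltEmbedding⟩
  rw [type_lt_Iio] at h1
  have := Ordinal.lift_le.1 (h1.trans h)
  exact absurd (Order.lt_succ o) this.not_gt

/-! ### Square sequences -/

/-- The consequences of the definition of a square sequence `c` that matter below, with order types
expressed by indices. -/
structure IsSquareSeq (c : Ordinal.{u} → Set Ordinal.{u}) : Prop where
  lt : ∀ α < ω_ 3, Order.IsSuccLimit α → ∀ ξ ∈ c α, ξ < α
  unbounded : ∀ α < ω_ 3, Order.IsSuccLimit α → ∀ γ < α, ∃ ξ ∈ c α, γ < ξ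
  index_lt : ∀ α < ω_ 3, Order.IsSuccLimit α → ∀ ξ ∈ c α, index (c α) ξ < ω_ 2
  coherent : ∀ α < ω_ 3, Order.IsSuccLimit α → ∀ β < α, IsLimitPoint β (c α) →
    ∀ ξ, ξ ∈ c β ↔ ξ ∈ c α ∧ ξ < β

theorem SquareOmega2.exists_isSquareSeq (h : SquareOmega2.{u}) :
    ∃ c : Ordinal.{u} → Set Ordinal.{u}, IsSquareSeq c := by
  obtain ⟨c, hc⟩ := h
  refine ⟨c, fun α hα hl ξ hξ => (hc α hα hl).1.1 hξ, fun α hα hl γ hγ => ?_,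
    fun α hα hl ξ hξ => index_lt_of_typeLT_le hξ ?_, fun α hα hl β hβ hlim ξ => ?_⟩
  · obtain ⟨ξ, hξ, hle⟩ := (hc α hα hl).1.2.isCofinal ⟨Order.succ γ, hl.succ_lt hγ⟩
    exact ⟨ξ.1, hξ, Order.succ_le_iff.1 hle⟩
  · simpa using (hc α hα hl).2.1
  · rw [← (hc α hα hl).2.2 β hβ hlim]; rfl

/-! ### Traces of models on `ω₃` -/

/-- The closure properties of `M ∩ ω₃` that matter, for a model `M` of size `ω₁`, with respect to a
square sequence `c` and functions `f β` enumerating `β` by `ω₂`, with right inverses `fi β`. In `otp_mem`,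
`index (c β) β` is the order type of `c β`. As `c β` is arbitrary when `β` is not a limit, `nth_mem`
and `next_mem` only concern elements below `β`. -/
structure IsRich (c : Ordinal.{u} → Set Ordinal.{u})
    (f fi : Ordinal.{u} → Ordinal.{u} → Ordinal.{u}) (A : Set Ordinal.{u}) : Prop where
  lt : ∀ a ∈ A, a < ω_ 3
  mk_le : #A ≤ ℵ₁
  nonempty : A.Nonempty
  succ_mem : ∀ a ∈ A, Order.succ a ∈ A
  pred_mem : ∀ a, Order.succ a ∈ A → a ∈ A
  apply_mem : ∀ β ∈ A, ∀ i ∈ A, f β i ∈ A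
  inv_mem : ∀ β ∈ A, ∀ ξ ∈ A, fi β ξ ∈ A
  otp_mem : ∀ β ∈ A, index (c β) β ∈ A
  nth_mem : ∀ β ∈ A, ∀ i ∈ A, ∀ η ∈ c β, η < β → index (c β) η = i → η ∈ A
  next_mem : ∀ β ∈ A, ∀ ξ ∈ A, ∀ η ∈ c β, η < β → ξ < η → (∀ η' ∈ c β, ξ < η' → η ≤ η') → η ∈ A
  down_mem : ∀ a ∈ A, a < ω_ 2 → ∀ b < a, b ∈ A
  iSup_mem : ∀ s : ℕ → Ordinal.{u}, (∀ n, s n ∈ A) → ⨆ n, s n ∈ A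

variable {c : Ordinal.{u} → Set Ordinal.{u}} {f fi : Ordinal.{u} → Ordinal.{u} → Ordinal.{u}}
  {A B : Set Ordinal.{u}} {α : Ordinal.{u}}

theorem exists_next {C : Set Ordinal.{u}} {ξ : Ordinal.{u}} (h : ∃ η ∈ C, ξ < η) :
    ∃ η ∈ C, ξ < η ∧ ∀ η' ∈ C, ξ < η' → η ≤ η' := by
  obtain ⟨h1, h2⟩ := csInf_mem (s := {η | η ∈ C ∧ ξ < η}) h
  exact ⟨_, h1, h2, fun η' h1 h2 => csInf_le' ⟨h1, h2⟩⟩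

/-- `α` is the supremum of `A`, and `A` has no maximum. -/
structure IsStrictSup (A : Set Ordinal.{u}) (α : Ordinal.{u}) : Prop where
  lt : ∀ a ∈ A, a < α
  exists_lt : ∀ γ < α, ∃ a ∈ A, γ < a

theorem IsStrictSup.unique {α' : Ordinal.{u}} (h : IsStrictSup A α) (h' : IsStrictSup A α') :
    α = α' := by
  refine le_antisymm ?_ ?_ <;> by_contra! hlt
  · obtain ⟨a, ha, hlt⟩ := h.exists_lt _ hlt
    exact (h'.lt a ha).not_gt hlt
  · obtain ⟨a, ha, hlt⟩ := h'.exists_lt _ hlt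
    exact (h.lt a ha).not_gt hlt

theorem sSup_lt_omega_three (h1 : ∀ a ∈ A, a < ω_ 3) (h2 : #A ≤ ℵ_ 2) : sSup A < ω_ 3 := by
  refine sSup_lt_of_lt_cof (h2.trans_lt ?_) h1
  have : (Ordinal.lift.{u + 1} (ω_ (3 : Ordinal.{u}))) = (ℵ_ (3 : Ordinal.{u + 1})).ord := by
    simp
  rw [this, isRegular_aleph_three.cof_ord, ← succ_aleph_two]
  exact Order.lt_succ _

theorem isStrictSup_sSup (hA : ∀ a ∈ A, a < ω_ 3) (hsucc : ∀ a ∈ A, Order.succ a ∈ A) :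
    IsStrictSup A (sSup A) := by
  have hb : BddAbove A := ⟨ω_ 3, fun a ha => (hA a ha).le⟩
  exact ⟨fun a ha => (Order.lt_succ a).trans_le (le_csSup hb (hsucc a ha)), fun γ hγ => by
    by_contra! hle
    exact hγ.not_ge (csSup_le' hle)⟩

theorem IsStrictSup.isSuccLimit (h : IsStrictSup A α) (hne : A.Nonempty) : Order.IsSuccLimit α := by
  rw [Order.isSuccLimit_iff_of_orderBot, Order.isSuccPrelimit_iff_succ_lt]
  obtain ⟨a, ha⟩ := hne
  refine ⟨((zero_le (a := a)).trans_lt (h.lt a ha)).ne', fun γ hγ => ?_⟩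
  obtain ⟨b, hb, hlt⟩ := h.exists_lt γ hγ
  exact (Order.succ_le_iff.2 hlt).trans_lt (h.lt b hb)

namespace IsRich

theorem inter (hA : IsRich c f fi A) (hB : IsRich c f fi B) (hne : (A ∩ B).Nonempty) :
    IsRich c f fi (A ∩ B) where
  lt a ha := hA.lt a ha.1
  mk_le := (mk_le_mk_of_subset Set.inter_subset_left).trans hA.mk_le
  nonempty := hne
  succ_mem a ha := ⟨hA.succ_mem a ha.1, hB.succ_mem a ha.2⟩
  pred_mem a ha := ⟨hA.pred_mem a ha.1, hB.pred_mem a ha.2⟩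
  apply_mem β hβ i hi := ⟨hA.apply_mem β hβ.1 i hi.1, hB.apply_mem β hβ.2 i hi.2⟩
  inv_mem β hβ i hi := ⟨hA.inv_mem β hβ.1 i hi.1, hB.inv_mem β hβ.2 i hi.2⟩
  otp_mem β hβ := ⟨hA.otp_mem β hβ.1, hB.otp_mem β hβ.2⟩
  nth_mem β hβ i hi η hη hl h :=
    ⟨hA.nth_mem β hβ.1 i hi.1 η hη hl h, hB.nth_mem β hβ.2 i hi.2 η hη hl h⟩
  next_mem β hβ ξ hξ η hη hl h h' :=
    ⟨hA.next_mem β hβ.1 ξ hξ.1 η hη hl h h', hB.next_mem β hβ.2 ξ hξ.2 η hη hl h h'⟩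
  down_mem a ha h b hb := ⟨hA.down_mem a ha.1 h b hb, hB.down_mem a ha.2 h b hb⟩
  iSup_mem s hs := ⟨hA.iSup_mem s fun n => (hs n).1, hB.iSup_mem s fun n => (hs n).2⟩

theorem isStrictSup (hA : IsRich c f fi A) : IsStrictSup A (sSup A) :=
  isStrictSup_sSup hA.lt hA.succ_mem

theorem sSup_lt (hA : IsRich c f fi A) : sSup A < ω_ 3 :=
  sSup_lt_omega_three hA.lt (hA.mk_le.trans aleph_one_lt_aleph_two.le)

theorem isSuccLimit_sSup (hA : IsRich c f fi A) : Order.IsSuccLimit (sSup A) :=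
  hA.isStrictSup.isSuccLimit hA.nonempty

/-- The limit points of `c α` which lie in `A` are unbounded in `α = sup A`: interleave elements of
`A` and of `c α` in an `ω`-sequence and take its supremum. -/
theorem exists_isLimitPoint (hc : IsSquareSeq c) (hA : IsRich c f fi A) {γ : Ordinal.{u}}
    (hγ : γ < sSup A) : ∃ β ∈ A, γ < β ∧ β < sSup A ∧ IsLimitPoint β (c (sSup A)) := by
  have hα := hA.isStrictSup
  have hnext : ∀ m : A, ∃ m' : A, ∃ ξ ∈ c (sSup A), m.1 < ξ ∧ ξ < m'.1 := fun m => by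
    obtain ⟨ξ, hξ, h1⟩ := hc.unbounded _ hA.sSup_lt hA.isSuccLimit_sSup m.1 (hα.lt _ m.2)
    obtain ⟨m', hm', h2⟩ := hα.exists_lt ξ (hc.lt _ hA.sSup_lt hA.isSuccLimit_sSup ξ hξ)
    exact ⟨⟨m', hm'⟩, ξ, hξ, h1, h2⟩
  choose g ξ hξ hlt hlt' using hnext
  obtain ⟨a, ha, hγa⟩ := hα.exists_lt γ hγ
  let s : ℕ → A := fun n => g^[n] ⟨a, ha⟩
  have hs : ∀ n, s (n + 1) = g (s n) := fun n => Function.iterate_succ_apply' _ _ _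
  have hle : ∀ n, (s n).1 ≤ ⨆ n, (s n).1 := Ordinal.le_iSup _
  have hβ : ⨆ n, (s n).1 ∈ A := hA.iSup_mem _ fun n => (s n).2
  refine ⟨_, hβ, hγa.trans_le (hle 0), hα.lt _ hβ, ?_, fun γ' hγ' => ?_⟩
  · exact (zero_le.trans_lt hγa).trans_le (hle 0)
  · obtain ⟨n, hn⟩ := (Ordinal.lt_iSup_iff).1 hγ'
    refine ⟨ξ (s n), hξ _, hn.trans (hlt _), (hlt' _).trans_le ?_⟩
    rw [← hs]
    exact hle _

/-- If `A ∩ ω₂ ⊆ δ` then `c (sup A)` has order type at most `δ`: it is the union of the `c β`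
for limit points `β ∈ A`, whose order types belong to `A ∩ ω₂`. -/
theorem index_lt_of_sSup (hc : IsSquareSeq c) (hA : IsRich c f fi A) {δ : Ordinal.{u}}
    (hδ : ∀ i ∈ A, i < ω_ 2 → i < δ) {η : Ordinal.{u}} (hη : η ∈ c (sSup A)) :
    index (c (sSup A)) η < δ := by
  have hl := hA.isSuccLimit_sSup
  obtain ⟨β, hβ, hηβ, hβα, hlim⟩ := hA.exists_isLimitPoint hc (hc.lt _ hA.sSup_lt hl η hη)
  have hcoh := hc.coherent _ hA.sSup_lt hl β hβα hlim
  have hix : index (c β) β = index (c (sSup A)) β :=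
    index_congr fun ζ hζ => (hcoh ζ).trans (and_iff_left hζ)
  obtain ⟨ξ, hξ, hβξ⟩ := hc.unbounded _ hA.sSup_lt hl β hβα
  refine (index_lt hη hηβ).trans (hix ▸ hδ _ (hA.otp_mem β hβ) ?_)
  rw [hix]
  exact (index_mono _ hβξ.le).trans_lt (hc.index_lt _ hA.sSup_lt hl ξ hξ)

/-- `sup (A ∩ B)` belongs to `B`, provided that `A ∩ ω₂ ⊆ δ ∈ B` and that `c (sup B)` has order type
at least `B ∩ ω₂`. -/
theorem sSup_inter_mem (hc : IsSquareSeq c) (hA : IsRich c f fi A) (hB : IsRich c f fi B)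
    (hne : (A ∩ B).Nonempty) {δ : Ordinal.{u}} (hδ : ∀ i ∈ A, i < ω_ 2 → i < δ) (hδω : δ < ω_ 2)
    (hδB : δ ∈ B) (hotp : ∀ i ∈ B, i < ω_ 2 → ∃ ξ ∈ c (sSup B), index (c (sSup B)) ξ = i) :
    sSup (A ∩ B) ∈ B := by
  have hP := hA.inter hB hne
  have hα := hP.isStrictSup
  have hδP : ∀ i ∈ A ∩ B, i < ω_ 2 → i < δ := fun i hi => hδ i hi.1
  set α := sSup (A ∩ B) with hαdef
  by_contra hαB
  by_cases hex : ∃ b ∈ B, α ≤ b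
  · -- The least element `α'` of `B` above `α` is a limit, and `α` is a limit point of `c α'`.
    obtain ⟨hα'B, hle⟩ := csInf_mem (s := {b | b ∈ B ∧ α ≤ b}) hex
    have hmin : ∀ b ∈ B, b < sInf {b | b ∈ B ∧ α ≤ b} → b < α := fun b hb hlt => by
      by_contra! hαb
      exact notMem_of_lt_csInf' hlt ⟨hb, hαb⟩
    set α' := sInf {b | b ∈ B ∧ α ≤ b}
    have hαα' : α < α' := hle.lt_of_ne fun h => hαB (h ▸ hα'B)
    have hα'3 : α' < ω_ 3 := hB.lt _ hα'B
    have hl' : Order.IsSuccLimit α' := by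
      rw [Order.isSuccLimit_iff_of_orderBot, Order.isSuccPrelimit_iff_succ_lt]
      refine ⟨(zero_le.trans_lt hαα').ne', fun γ hγ => ?_⟩
      refine (Order.succ_le_of_lt hγ).lt_of_ne fun h => ?_
      have h1 := hmin γ (hB.pred_mem γ (h ▸ hα'B)) hγ
      exact (Order.succ_le_of_lt h1).not_gt (h ▸ hαα')
    have hlim : IsLimitPoint α (c α') := by
      refine ⟨(hP.isSuccLimit_sSup).bot_lt, fun γ hγ => ?_⟩
      obtain ⟨ξ, hξ, hγξ⟩ := hα.exists_lt γ hγ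
      obtain ⟨η, hη, hξη, hηmin⟩ :=
        exists_next (hc.unbounded α' hα'3 hl' ξ ((hα.lt ξ hξ).trans hαα'))
      have hηα' := hc.lt α' hα'3 hl' η hη
      have hηB := hB.next_mem α' hα'B ξ hξ.2 η hη hηα' hξη hηmin
      exact ⟨η, hη, hγξ.trans hξη, hmin η hηB hηα'⟩
    have hcoh := hc.coherent α' hα'3 hl' α hαα' hlim
    by_cases hη : ∃ η ∈ c α', index (c α') η = δ
    · -- This `η` lies in `B`, hence in `c α`, whose indices are below `δ`.
      obtain ⟨η, hη, hηδ⟩ := hη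
      have hηα' := hc.lt α' hα'3 hl' η hη
      have hηα := hmin η (hB.nth_mem α' hα'B δ hδB η hη hηα' hηδ) hηα'
      have h1 := hP.index_lt_of_sSup hc hδP ((hcoh η).2 ⟨hη, hηα⟩)
      have h2 : index (c (sSup (A ∩ B))) η = index (c α') η := index_congr fun ζ hζ =>
        (hcoh ζ).trans (and_iff_left (hζ.trans hηα))
      rw [h2, hηδ] at h1
      exact h1.false
    · -- All indices of `c α'` are below `δ`, so `c α' ⊆ B`, but `B` does not meet `[α, α')`.
      obtain ⟨η, hη', hαη⟩ := hc.unbounded α' hα'3 hl' α hαα'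
      have hηδ : index (c α') η < δ := by
        by_contra! hge
        rcases hge.lt_or_eq with hlt | heq
        · obtain ⟨ζ, hζ, -, h⟩ := exists_index_eq hlt
          exact hη ⟨ζ, hζ, h⟩
        · exact hη ⟨η, hη', heq.symm⟩
      have hηα' := hc.lt α' hα'3 hl' η hη'
      have hηB := hB.nth_mem α' hα'B _ (hB.down_mem δ hδB hδω _ hηδ) η hη' hηα' rfl
      exact (hmin η hηB hηα').not_gt hαη
  · -- `α` is the supremum of `B`, so that `hotp` applies to it.
    push Not at hex
    have hαB : sSup B = α := hB.isStrictSup.unique ⟨hex, fun γ hγ => by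
      obtain ⟨a, ha, h⟩ := hα.exists_lt γ hγ
      exact ⟨a, ha.2, h⟩⟩
    rw [hαB] at hotp
    obtain ⟨ξ, hξ, h⟩ := hotp δ hδB hδω
    exact (h ▸ hP.index_lt_of_sSup hc hδP hξ).false

/-- `A ∩ B` can be computed from `sup (A ∩ B)` and `δ = A ∩ ω₂`. -/
theorem mem_inter_iff (hc : IsSquareSeq c)
    (hf : ∀ β < ω_ 3, ∀ ξ < β, fi β ξ < ω_ 2 ∧ f β (fi β ξ) = ξ)
    (hA : IsRich c f fi A) (hB : IsRich c f fi B)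
    (hne : (A ∩ B).Nonempty) {δ : Ordinal.{u}} (hδ : ∀ i < ω_ 2, i ∈ A ↔ i < δ) (hδω : δ < ω_ 2)
    (hδB : δ ∈ B) (ξ : Ordinal.{u}) :
    ξ ∈ A ∩ B ↔ ∃ β ∈ c (sSup (A ∩ B)), ∃ i < δ, ξ = f β i := by
  have hP := hA.inter hB hne
  have hα := hP.isStrictSup
  have hl := hP.isSuccLimit_sSup
  have hδP : ∀ i ∈ A ∩ B, i < ω_ 2 → i < δ := fun i hi hi2 => (hδ i hi2).1 hi.1
  have hP' : ∀ i < δ, i ∈ A ∩ B := fun i hi =>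
    ⟨(hδ i (hi.trans hδω)).2 hi, hB.down_mem δ hδB hδω i hi⟩
  -- `β` is the element of some `c β'` with `β' ∈ A ∩ B` whose index is below `δ`
  have hcP : ∀ β ∈ c (sSup (A ∩ B)), β ∈ A ∩ B := fun β hβ => by
    have hβα := hc.lt _ hP.sSup_lt hl β hβ
    obtain ⟨β', hβ', hββ', hβ'α, hlim⟩ := hP.exists_isLimitPoint hc hβα
    have hcoh := hc.coherent _ hP.sSup_lt hl β' hβ'α hlim
    refine hP.nth_mem β' hβ' _ (hP' _ ?_) β ((hcoh β).2 ⟨hβ, hββ'⟩) hββ' rfl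
    have h2 : index (c β') β = index (c (sSup (A ∩ B))) β := index_congr fun ζ hζ =>
        (hcoh ζ).trans (and_iff_left (hζ.trans hββ'))
    rw [h2]
    exact hP.index_lt_of_sSup hc hδP hβ
  constructor
  · intro hξ
    obtain ⟨β, hβ, hξβ⟩ := hc.unbounded _ hP.sSup_lt hl ξ (hα.lt ξ hξ)
    obtain ⟨h1, h2⟩ := hf β (hP.lt β (hcP β hβ)) ξ hξβ
    exact ⟨β, hβ, fi β ξ, hδP _ (hP.inv_mem β (hcP β hβ) ξ hξ) h1, h2.symm⟩
  · rintro ⟨β, hβ, i, hi, rfl⟩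
    exact hP.apply_mem β (hcP β hβ) i (hP' i hi)

end IsRich

/-! ### Models closed under operations of countable arity -/

/-- The members of `H(ω₃)`. -/
abbrev HMem : Type (u + 1) := H.{u} (ℵ_ 3)

/-- `X` is closed under the set-valued operation `Ω` of countable arity. -/
def ClosedUnder (Ω : (ℕ → HMem.{u}) → Set HMem.{u}) (X : Set HMem.{u}) : Prop :=
  ∀ s : ℕ → HMem, (∀ n, s n ∈ X) → Ω s ⊆ X

theorem ClosedUnder.inter {Ω : (ℕ → HMem.{u}) → Set HMem.{u}} {X X' : Set HMem.{u}}
    (h : ClosedUnder Ω X) (h' : ClosedUnder Ω X') : ClosedUnder Ω (X ∩ X') := fun s hs =>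
  Set.subset_inter (h s fun n => (hs n).1) (h' s fun n => (hs n).2)

/-- The ordinals in `X`. -/
def ords (X : Set HMem.{u}) : Set Ordinal.{u} :=
  {α | ∃ w ∈ X, w.1 = α.toZFSet}

/-- The members of `M` which lie in `H(ω₃)`. -/
def elems (M : ZFSet.{u}) : Set HMem.{u} :=
  {w | w.1 ∈ M}

theorem elems_inter (M N : ZFSet.{u}) : elems (M ∩ N) = elems M ∩ elems N := by
  ext w; exact ZFSet.mem_inter

theorem lt_of_mem_ords {X : Set HMem.{u}} {α : Ordinal.{u}} (h : α ∈ ords X) : α < ω_ 3 := by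
  obtain ⟨w, -, hw⟩ := h
  exact toZFSet_mem_H_iff.1 (hw ▸ w.2)

theorem mem_ords_iff {X : Set HMem.{u}} {α : Ordinal.{u}} (hα : α < ω_ 3) :
    α ∈ ords X ↔ ⟨α.toZFSet, toZFSet_mem_H_iff.2 hα⟩ ∈ X := by
  constructor
  · rintro ⟨w, hw, h⟩
    convert hw
    exact h.symm
  · exact fun h => ⟨_, h, rfl⟩

theorem ords_inter (X X' : Set HMem.{u}) : ords (X ∩ X') = ords X ∩ ords X' := by
  ext α
  constructor
  · rintro ⟨w, ⟨h, h'⟩, hw⟩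
    exact ⟨⟨w, h, hw⟩, ⟨w, h', hw⟩⟩
  · rintro ⟨⟨w, h, hw⟩, ⟨w', h', hw'⟩⟩
    rw [← hw] at hw'
    exact ⟨w, ⟨h, Subtype.ext hw' ▸ h'⟩, hw⟩

theorem mk_ords_le (X : Set HMem.{u}) : #(ords X) ≤ #X := by
  choose g hg hg' using fun α : ords X => α.2
  refine mk_le_of_injective (f := fun α => (⟨g α, hg α⟩ : X)) fun α β h => Subtype.ext ?_
  have : g α = g β := congrArg Subtype.val h
  apply toZFSet_injective
  rw [← hg', ← hg', this]

/-- The members of `H(ω₃)` which are ordinals from `S`. -/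
def ofOrds (S : Set Ordinal.{u}) : Set HMem.{u} :=
  {w | ∃ α ∈ S, w.1 = α.toZFSet}

theorem mk_ofOrds_le (S : Set Ordinal.{u}) : #(ofOrds S) ≤ #S := by
  choose g hg hg' using fun w : ofOrds S => w.2
  refine mk_le_of_injective (f := fun w => (⟨g w, hg w⟩ : S)) fun w w' h => ?_
  have h : g w = g w' := congrArg Subtype.val h
  exact Subtype.ext (Subtype.ext (by rw [hg' w, hg' w', h]))

theorem ords_ofOrds {S : Set Ordinal.{u}} (hS : ∀ α ∈ S, α < ω_ 3) : ords (ofOrds S) = S := by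
  ext α
  constructor
  · rintro ⟨w, ⟨β, hβ, h⟩, h'⟩
    exact toZFSet_injective (h'.symm.trans h) ▸ hβ
  · exact fun h => ⟨⟨_, toZFSet_mem_H_iff.2 (hS α h)⟩, ⟨α, h, rfl⟩, rfl⟩

theorem ofOrds_subset {S : Set Ordinal.{u}} {X : Set HMem.{u}} (h : S ⊆ ords X) :
    ofOrds S ⊆ X := by
  rintro w ⟨α, hα, hw⟩
  obtain ⟨w', hw', h⟩ := h hα
  exact Subtype.ext (hw.trans h.symm) ▸ hw'

theorem mem_ords_elems {M : ZFSet.{u}} (hM : ∀ x ∈ M, x ∈ H (ℵ_ 3)) {α : Ordinal.{u}} :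
    α ∈ ords (elems M) ↔ α.toZFSet ∈ M :=
  ⟨fun ⟨_, hw, h⟩ => h ▸ hw, fun h => ⟨⟨_, hM _ h⟩, h, rfl⟩⟩

theorem mk_elems {M : ZFSet.{u}} (hM : ∀ x ∈ M, x ∈ H (ℵ_ 3)) : #(elems M) = #M :=
  mk_congr ⟨fun w => ⟨w.1.1, w.2⟩, fun x => ⟨⟨x.1, hM _ x.2⟩, x.2⟩, fun _ => rfl, fun _ => rfl⟩

/-- A square sequence `c`, for each `β < ω₃` a function from `ω₂` whose values include all ordinals
below `β`, with a right inverse on `β`, and a function from `ω₃` onto `H(ω₃)` with a right inverse.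
All functions are extended to all ordinals. -/
structure Coding where
  /-- The square sequence. -/
  c : Ordinal.{u} → Set Ordinal.{u}
  /-- `f β` enumerates `β` in terms of ordinals below `ω₂`. -/
  f : Ordinal.{u} → Ordinal.{u} → Ordinal.{u}
  /-- The right inverse of `f β`. -/
  fi : Ordinal.{u} → Ordinal.{u} → Ordinal.{u}
  /-- The enumeration of `H(ω₃)`. -/
  e : Ordinal.{u} → HMem.{u}
  /-- The right inverse of `e`. -/
  ei : HMem.{u} → Ordinal.{u}
  square : IsSquareSeq c
  f_lt : ∀ β i, f β i < ω_ 3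
  fi_lt : ∀ β ξ, fi β ξ < ω_ 2
  f_fi : ∀ β < ω_ 3, ∀ ξ < β, f β (fi β ξ) = ξ
  ei_lt : ∀ w, ei w < ω_ 3
  e_ei : ∀ w, e (ei w) = w

instance : Nonempty HMem.{u} := ⟨⟨_, toZFSet_mem_H_iff.2 omega_two_lt_omega_three⟩⟩

theorem exists_injective_of_mk_le {α : Type (u + 1)} {o : Ordinal.{u}}
    (h : #α ≤ Cardinal.lift.{u + 1} o.card) :
    ∃ g : α → Ordinal.{u}, g.Injective ∧ ∀ a, g a < o := by
  rw [← Cardinal.mk_Iio_ordinal] at h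
  obtain ⟨g⟩ := h
  exact ⟨fun a => (g a).1, fun a b hab => g.injective (Subtype.ext hab), fun a => (g a).2⟩

theorem exists_coding (hpow : (2 : Cardinal.{u + 1}) ^ (ℵ_ 2 : Cardinal.{u + 1}) = ℵ_ 3)
    (hsq : SquareOmega2.{u}) : Nonempty Coding.{u} := by
  obtain ⟨c, hc⟩ := hsq.exists_isSquareSeq
  have h2 : (0 : Ordinal.{u}) < ω_ 2 := omega_pos 2
  have h3 : (0 : Ordinal.{u}) < ω_ 3 := omega_pos 3
  obtain ⟨ei, hei, hei3⟩ := exists_injective_of_mk_le (α := HMem.{u}) (o := ω_ 3)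
    ((mk_H_le hpow).trans (by simp))
  have hfi : ∀ β : Ordinal.{u}, ∃ fi : Ordinal.{u} → Ordinal.{u}, (∀ ξ, fi ξ < ω_ 2) ∧
      (β < ω_ 3 → Set.InjOn fi (Set.Iio β)) := fun β => by
    by_cases hβ : β < ω_ 3
    · obtain ⟨g, hg, hg2⟩ := exists_injective_of_mk_le (α := Set.Iio β) (o := ω_ 2) (by
        rw [Cardinal.mk_Iio_ordinal, Cardinal.lift_le, card_omega]
        exact card_le_aleph_two_iff.2 hβ)
      classical
      refine ⟨fun ξ => if h : ξ < β then g ⟨ξ, h⟩ else 0, fun ξ => ?_, fun _ ξ hξ ξ' hξ' h => ?_⟩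
      · dsimp only; split_ifs; exacts [hg2 _, h2]
      · have hξ : ξ < β := hξ
        have hξ' : ξ' < β := hξ'
        simp only [hξ, hξ', dif_pos] at h
        exact congrArg Subtype.val (hg h)
    · exact ⟨fun _ => 0, fun _ => h2, fun h => absurd h hβ⟩
  choose fi hfi2 hfii using hfi
  classical
  refine ⟨⟨c, fun β i => if h : β < ω_ 3 ∧ ∃ ξ < β, fi β ξ = i then h.2.choose else 0, fi,
    Function.invFun ei, ei, hc, fun β i => ?_, hfi2, fun β hβ ξ hξ => ?_, hei3,
    Function.leftInverse_invFun hei⟩⟩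
  · split_ifs with h
    exacts [h.2.choose_spec.1.trans h.1, h3]
  · have h : β < ω_ 3 ∧ ∃ ξ' < β, fi β ξ' = fi β ξ := ⟨hβ, ξ, hξ, rfl⟩
    rw [dif_pos h]
    exact hfii β hβ h.2.choose_spec.1 hξ h.2.choose_spec.2

/-! ### The language of set theory -/

instance : Countable memLang.Symbols := by
  have h1 : ∀ n, IsEmpty (memLang.Functions n) := fun n => inferInstanceAs (IsEmpty Empty)
  have h2 : ∀ n, Countable (memLang.Relations n) := fun n => by
    have : Subsingleton (MemRel n) := ⟨by rintro ⟨⟩ ⟨⟩; rfl⟩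
    exact inferInstanceAs (Countable (MemRel n))
  unfold FirstOrder.Language.Symbols
  infer_instance

/-- Witnesses in `H(ω₃)` for all formulas, with the parameters of a formula taken from the
beginning of the sequence `s`. The witness is an arbitrary member of `H(ω₃)` for a formula without witnesses. -/
noncomputable def skolemOps (s : ℕ → HMem.{u}) : Set HMem.{u} :=
  Set.range fun p : Σ n, memLang.BoundedFormula Empty (n + 1) =>
    Classical.epsilon fun a => p.2.Realize default (Fin.snoc (fun i => s i) a)

theorem mk_skolemOps_le (s : ℕ → HMem.{u}) : #(skolemOps s) ≤ ℵ₀ := by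
  have : Countable (Σ n, memLang.BoundedFormula Empty (n + 1)) := by
    refine Function.Injective.countable
      (f := fun p => (⟨p.1 + 1, p.2⟩ : Σ n, memLang.BoundedFormula Empty n)) ?_
    rintro ⟨n, φ⟩ ⟨m, ψ⟩ h
    simp only [Sigma.mk.injEq, Nat.add_right_cancel_iff] at h
    obtain ⟨rfl, h⟩ := h
    simp at h
    rw [h]
  exact mk_le_aleph0_iff.2 (Set.countable_range _)

/-- The Tarski-Vaught test. -/
theorem isElementaryIn_of_closedUnder {M : ZFSet.{u}} (hM : ∀ x ∈ M, x ∈ H (ℵ_ 3))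
    (hne : (elems M).Nonempty) (h : ClosedUnder skolemOps (elems M)) :
    IsElementaryIn M (H (ℵ_ 3)) := by
  let S : memLang.Substructure HMem.{u} := ⟨elems M, fun {n} f => nomatch f⟩
  obtain ⟨w₀, hw₀⟩ := hne
  refine ⟨S.toElementarySubstructure fun n φ x a ha => ?_, ?_⟩
  · let s : ℕ → HMem.{u} := fun i => if h : i < n then (x ⟨i, h⟩).1 else w₀
    have hs : (fun i : Fin n => s i) = (↑) ∘ x := by ext i; simp [s]
    have hsM : ∀ i, s i ∈ elems M := fun i => by
      simp only [s]; split_ifs; exacts [(x _).2, hw₀]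
    have hmem := h s hsM ⟨⟨n, φ⟩, rfl⟩
    dsimp only at hmem
    rw [hs] at hmem
    refine ⟨⟨_, hmem⟩, ?_⟩
    exact Classical.epsilon_spec (p := fun a => φ.Realize default (Fin.snoc ((↑) ∘ x) a)) ⟨a, ha⟩
  · ext x
    constructor
    · rintro ⟨w, hw, rfl⟩; exact hw
    · exact fun hx => ⟨⟨x, hM x hx⟩, hx, rfl⟩

/-! ### The models of the family -/

theorem exists_eq_toZFSet_of_mem_omega {x : ZFSet.{u}} (h : x ∈ ZFSet.omega) :
    ∃ n : ℕ, x = (n : Ordinal.{u}).toZFSet := by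
  have h0 : ∀ n : ℕ, ZFSet.mk (PSet.ofNat n) = (n : Ordinal.{u}).toZFSet := fun n => by
    induction n with
    | zero => simp only [Nat.cast_zero, toZFSet_zero]; rfl
    | succ n ih => rw [Nat.cast_succ, toZFSet_add_one, ← ih]; rfl
  induction x using Quotient.inductionOn with
  | h x =>
    obtain ⟨⟨n⟩, hn⟩ := h
    exact ⟨n, (ZFSet.sound hn).trans (h0 n)⟩

namespace Coding

variable (𝒞 : Coding.{u})

/-- The operations on ordinals under which models are closed, applied to the sequence `r`. -/
noncomputable def ordOps (r : ℕ → Ordinal.{u}) : Set Ordinal.{u} :=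
  ({Order.succ (r 0), 𝒞.f (r 0) (r 1), 𝒞.fi (r 0) (r 1), index (𝒞.c (r 0)) (r 0), ⨆ n, r n} ∪
    {a | Order.succ a = r 0}) ∪ ({η | η ∈ 𝒞.c (r 0) ∧ index (𝒞.c (r 0)) η = r 1} ∪
    {η | η ∈ 𝒞.c (r 0) ∧ r 1 < η ∧ ∀ η' ∈ 𝒞.c (r 0), r 1 < η' → η ≤ η'}) ∪
    {b | b < r 0 ∧ r 0 < ω_ 2}

/-- The operations under which models are closed. Ordinals are read off the members of `s` by
`rank`, which inverts `toZFSet` and is total. The last two operations are the set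
`{e (f β i) | β ∈ c (r 0), i < r 1}`, where `r` is the sequence of ranks of members of `s`, and the
sequence `s` itself as a function on `ω`. -/
noncomputable def ops (s : ℕ → HMem.{u}) : Set HMem.{u} :=
  (ofOrds (𝒞.ordOps fun n => (s n).1.rank) ∪ skolemOps s) ∪
    ({𝒞.e (s 0).1.rank} ∪ {w | w.1 = (𝒞.ei (s 0)).toZFSet}) ∪
    ({w | ∀ x, x ∈ w.1 ↔ ∃ β ∈ 𝒞.c (s 0).1.rank, ∃ i < (s 1).1.rank, x = (𝒞.e (𝒞.f β i)).1} ∪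
    {w | ∀ x, x ∈ w.1 ↔ ∃ n : ℕ, x = ZFSet.pair (n : Ordinal.{u}).toZFSet (s n).1})

theorem mk_ordOps_le (r : ℕ → Ordinal.{u}) : #(𝒞.ordOps r) ≤ ℵ₁ := by
  refine mk_union_le_aleph_one (mk_union_le_aleph_one (mk_union_le_aleph_one ?_ ?_)
    (mk_union_le_aleph_one ?_ ?_)) ?_
  · exact ((Set.toFinite _).lt_aleph0.le).trans (aleph0_le_aleph 1)
  · exact mk_le_aleph_one_of_subsingleton fun a ha b hb => Order.succ_injective (ha.trans hb.symm)
  · exact mk_le_aleph_one_of_subsingleton fun a ha b hb =>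
      index_injOn _ ha.1 hb.1 (ha.2.trans hb.2.symm)
  · exact mk_le_aleph_one_of_subsingleton fun a ha b hb =>
      (ha.2.2 b hb.1 hb.2.1).antisymm (hb.2.2 a ha.1 ha.2.1)
  · by_cases h : r 0 < ω_ 2
    · refine (mk_le_mk_of_subset (t := Set.Iio (r 0)) fun b hb => hb.1).trans ?_
      exact mk_Iio_le_aleph_one h
    · exact mk_le_aleph_one_of_subsingleton fun a ha => absurd ha.2 h

theorem mk_ops_le (s : ℕ → HMem.{u}) : #(𝒞.ops s) ≤ ℵ₁ := by
  refine mk_union_le_aleph_one (mk_union_le_aleph_one (mk_union_le_aleph_one ?_ ?_)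
    (mk_union_le_aleph_one ?_ ?_)) (mk_union_le_aleph_one ?_ ?_)
  · exact (mk_ofOrds_le _).trans (𝒞.mk_ordOps_le _)
  · exact (mk_skolemOps_le s).trans (aleph0_le_aleph 1)
  · exact mk_le_aleph_one_of_subsingleton fun a ha b hb => ha.trans hb.symm
  · exact mk_le_aleph_one_of_subsingleton fun a ha b hb => Subtype.ext (ha.trans hb.symm)
  · exact mk_le_aleph_one_of_subsingleton fun a ha b hb => Subtype.ext <| ZFSet.ext fun x =>
      (ha x).trans (hb x).symm
  · exact mk_le_aleph_one_of_subsingleton fun a ha b hb => Subtype.ext <| ZFSet.ext fun x =>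
      (ha x).trans (hb x).symm

/-- `M` is a subset of `H(ω₃)` of size `ω₁`, has `ω₁` as a member and is closed under `𝒞.ops`.
Then `ω₁ ⊆ M`, and intersections of models have size `ω₁`. -/
structure IsModel (M : ZFSet.{u}) : Prop where
  mem_H : ∀ x ∈ M, x ∈ H (ℵ_ 3)
  card_eq : M.card = ℵ₁
  omega_one_mem : (ω_ 1).toZFSet ∈ M
  closed : ClosedUnder 𝒞.ops (elems M)

/-- `c (sup (N ∩ ω₃))` has elements of all indices in `N ∩ ω₂`. -/
def IsLong (N : ZFSet.{u}) : Prop :=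
  ∀ i ∈ ords (elems N), i < ω_ 2 → ∃ ξ ∈ 𝒞.c (sSup (ords (elems N))),
    index (𝒞.c (sSup (ords (elems N)))) ξ = i

variable {𝒞} {X : Set HMem.{u}} {M N : ZFSet.{u}}

theorem ordOps_subset (hX : ClosedUnder 𝒞.ops X) {r : ℕ → Ordinal.{u}} (hr : ∀ n, r n ∈ ords X)
    {o : Ordinal.{u}} (ho : o ∈ 𝒞.ordOps r) (ho3 : o < ω_ 3) : o ∈ ords X := by
  choose s hs hsr using hr
  rw [mem_ords_iff ho3]
  have hrk : (fun n => (s n).1.rank) = r := by ext n; rw [hsr, rank_toZFSet]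
  refine hX s hs (Or.inl (Or.inl (Or.inl ⟨o, ?_, rfl⟩)))
  rwa [hrk]

theorem isRich (hX : ClosedUnder 𝒞.ops X) (hcard : #X ≤ ℵ₁) (hne : (ords X).Nonempty) :
    IsRich 𝒞.c 𝒞.f 𝒞.fi (ords X) := by
  -- operations in one and two arguments, seen as operations in sequences
  have h2 : ∀ a ∈ ords X, ∀ b ∈ ords X, ∀ o < ω_ 3, o ∈ 𝒞.ordOps (fun n => if n = 0 then a else b) →
      o ∈ ords X := fun a ha b hb o ho3 ho =>
    ordOps_subset hX (fun n => by split_ifs <;> assumption) ho ho3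
  have hl : Order.IsSuccLimit (ω_ (3 : Ordinal.{u})) := isSuccLimit_omega 3
  exact {
    lt := fun a ha => lt_of_mem_ords ha
    mk_le := (mk_ords_le X).trans hcard
    nonempty := hne
    succ_mem := fun a ha => h2 a ha a ha _ (hl.succ_lt (lt_of_mem_ords ha)) (by simp [ordOps])
    pred_mem := fun a ha => h2 _ ha _ ha a ((Order.lt_succ a).trans (lt_of_mem_ords ha))
      (by simp [ordOps])
    apply_mem := fun β hβ i hi => h2 β hβ i hi _ (𝒞.f_lt β i) (by simp [ordOps])
    inv_mem := fun β hβ ξ hξ => h2 β hβ ξ hξ _ ((𝒞.fi_lt β ξ).trans omega_two_lt_omega_three)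
      (by simp [ordOps])
    otp_mem := fun β hβ => h2 β hβ β hβ _ ((index_le_self _ _).trans_lt (lt_of_mem_ords hβ))
      (by simp [ordOps])
    nth_mem := fun β hβ i hi η hη hηβ h => h2 β hβ i hi η (hηβ.trans (lt_of_mem_ords hβ))
      (Or.inl (Or.inr (Or.inl ⟨hη, h⟩)))
    next_mem := fun β hβ ξ hξ η hη hηβ h h' => h2 β hβ ξ hξ η (hηβ.trans (lt_of_mem_ords hβ))
      (Or.inl (Or.inr (Or.inr ⟨hη, h, h'⟩)))
    down_mem := fun a ha h b hb => h2 a ha a ha b (hb.trans (lt_of_mem_ords ha))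
      (Or.inr ⟨hb, h⟩)
    iSup_mem := fun s hs => ordOps_subset hX hs (by simp [ordOps])
      (sSup_lt_omega_three (by rintro _ ⟨n, rfl⟩; exact lt_of_mem_ords (hs n))
        ((mk_le_aleph0_iff.2 (Set.countable_range s)).trans (aleph0_le_aleph 2))) }

theorem ei_mem (hX : ClosedUnder 𝒞.ops X) {w : HMem.{u}} (hw : w ∈ X) : 𝒞.ei w ∈ ords X := by
  rw [mem_ords_iff (𝒞.ei_lt w)]
  exact hX (fun _ => w) (fun _ => hw) (Or.inl (Or.inr (Or.inr rfl)))

theorem e_mem (hX : ClosedUnder 𝒞.ops X) {α : Ordinal.{u}} (hα : α ∈ ords X) : 𝒞.e α ∈ X := by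
  obtain ⟨w, hw, h⟩ := hα
  refine hX (fun _ => w) (fun _ => hw) (Or.inl (Or.inr (Or.inl ?_)))
  rw [Set.mem_singleton_iff, h, rank_toZFSet]

namespace IsModel

theorem mk_elems_eq (hM : 𝒞.IsModel M) : #(elems M) = ℵ₁ := by
  rw [mk_elems hM.mem_H, card_eq_aleph_one_iff.1 hM.card_eq]

theorem omega_one_mem_ords (hM : 𝒞.IsModel M) : ω_ 1 ∈ ords (elems M) :=
  (mem_ords_elems hM.mem_H).2 hM.omega_one_mem

theorem isRich (hM : 𝒞.IsModel M) : IsRich 𝒞.c 𝒞.f 𝒞.fi (ords (elems M)) :=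
  Coding.isRich hM.closed hM.mk_elems_eq.le ⟨_, hM.omega_one_mem_ords⟩

theorem mem_subsetsOmega1 (hM : 𝒞.IsModel M) : M ∈ subsetsOmega1 (H (ℵ_ 3)) :=
  ⟨hM.mem_H, hM.card_eq⟩

theorem isElementaryIn (hM : 𝒞.IsModel M) : IsElementaryIn M (H (ℵ_ 3)) :=
  isElementaryIn_of_closedUnder hM.mem_H ⟨⟨_, hM.mem_H _ hM.omega_one_mem⟩, hM.omega_one_mem⟩
    fun s hs => (show skolemOps s ⊆ 𝒞.ops s from fun _ h => Or.inl (Or.inl (Or.inr h))).trans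
      (hM.closed s hs)

theorem isOmegaClosed (hM : 𝒞.IsModel M) : IsOmegaClosed M := by
  intro g hg
  obtain ⟨hsub, huniq⟩ := ZFSet.mem_funs.1 hg
  have hnat : ∀ n : ℕ, (n : Ordinal.{u}).toZFSet ∈ ZFSet.omega.{u} := fun n => by
    induction n with
    | zero => rw [Nat.cast_zero, toZFSet_zero]; exact ZFSet.omega_zero
    | succ n ih => rw [Nat.cast_succ, toZFSet_add_one]; exact ZFSet.omega_succ ih
  choose s hs huniq' using fun n : ℕ => huniq _ (hnat n)
  have hsM : ∀ n, s n ∈ M := fun n => by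
    obtain ⟨a, -, b, hb, h⟩ := ZFSet.mem_prod.1 (hsub (hs n))
    rw [(ZFSet.pair_inj.1 h).2]; exact hb
  have hg' : ∀ x, x ∈ g ↔ ∃ n : ℕ, x = ZFSet.pair (n : Ordinal.{u}).toZFSet (s n) := fun x => by
    constructor
    · intro hx
      obtain ⟨a, ha, b, hb, rfl⟩ := ZFSet.mem_prod.1 (hsub hx)
      obtain ⟨n, rfl⟩ := exists_eq_toZFSet_of_mem_omega ha
      exact ⟨n, by rw [huniq' n b hx]⟩
    · rintro ⟨n, rfl⟩; exact hs n
  have hgH : g ∈ H (ℵ_ 3) := by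
    refine mem_H_of_forall_mem (fun x hx => ?_) ?_
    · obtain ⟨n, rfl⟩ := (hg' x).1 hx
      exact pair_mem_H (toZFSet_mem_H_iff.2 ((natCast_lt_omega0 n).trans_le
        (omega0_le_omega 3))) (hM.mem_H _ (hsM n))
    · have : {x | x ∈ g} = Set.range fun n : ℕ =>
          ZFSet.pair (n : Ordinal.{u}).toZFSet (s n) := by
        ext x; exact (hg' x).trans ⟨fun ⟨n, h⟩ => ⟨n, h.symm⟩, fun ⟨n, h⟩ => ⟨n, h.symm⟩⟩
      have h2 : #{x | x ∈ g} ≤ ℵ₀ := by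
        rw [this]; exact mk_le_aleph0_iff.2 (Set.countable_range _)
      exact h2.trans (aleph0_le_aleph 2)
  exact hM.closed (fun n => ⟨s n, hM.mem_H _ (hsM n)⟩) hsM
    (show (⟨g, hgH⟩ : HMem.{u}) ∈ _ from Or.inr (Or.inr hg'))

theorem inter (hM : 𝒞.IsModel M) (hN : 𝒞.IsModel N) : 𝒞.IsModel (M ∩ N) := by
  have hH : ∀ x ∈ M ∩ N, x ∈ H (ℵ_ 3) := fun x hx => hM.mem_H x (ZFSet.mem_inter.1 hx).1
  have hω : ∀ {M}, 𝒞.IsModel M → ∀ i < ω_ 1, i.toZFSet ∈ M := fun hM i hi =>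
    (mem_ords_elems hM.mem_H).1
      (hM.isRich.down_mem _ hM.omega_one_mem_ords omega_one_lt_omega_two i hi)
  refine ⟨hH, le_antisymm ?_ ?_, ZFSet.mem_inter.2 ⟨hM.omega_one_mem, hN.omega_one_mem⟩, ?_⟩
  · rw [← hM.card_eq]
    exact ZFSet.card_mono fun x hx => (ZFSet.mem_inter.1 hx).1
  · have : (ω_ 1).toZFSet ⊆ M ∩ N := fun x hx => by
      obtain ⟨i, hi, rfl⟩ := mem_toZFSet_iff.1 hx
      exact ZFSet.mem_inter.2 ⟨hω hM i hi, hω hN i hi⟩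
    have := ZFSet.card_mono this
    rwa [card_toZFSet, card_omega] at this
  · rw [elems_inter]
    exact hM.closed.inter hN.closed

/-- `M ∩ ω₂` is an ordinal `δ < ω₂`, the least ordinal not in `M`. -/
theorem exists_inter_omega2_eq (hM : 𝒞.IsModel M) : ∃ δ < ω_ 2, M ∩ omega2 = δ.toZFSet ∧
    ∀ i < ω_ 2, i ∈ ords (elems M) ↔ i < δ := by
  have hex : ∃ δ, δ < ω_ 2 ∧ δ ∉ ords (elems M) := by
    by_contra! h
    have h1 := (mk_le_mk_of_subset (s := Set.Iio (ω_ 2)) h).trans hM.isRich.mk_le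
    rw [Cardinal.mk_Iio_ordinal, card_omega, lift_aleph] at h1
    rw [Ordinal.lift_ofNat] at h1
    exact aleph_one_lt_aleph_two.not_ge h1
  obtain ⟨hδ, hδM⟩ := csInf_mem (s := {δ | δ < ω_ 2 ∧ δ ∉ ords (elems M)}) hex
  set δ := sInf {δ | δ < ω_ 2 ∧ δ ∉ ords (elems M)} with hδdef
  have hiff : ∀ i < ω_ 2, i ∈ ords (elems M) ↔ i < δ := fun i hi => by
    constructor
    · intro h
      by_contra! hle
      rcases hle.lt_or_eq with hlt | heq
      · exact hδM (hM.isRich.down_mem i h hi δ hlt)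
      · exact hδM (heq ▸ h)
    · intro h
      by_contra hi'
      exact notMem_of_lt_csInf' h ⟨hi, hi'⟩
  refine ⟨δ, hδ, ?_, hiff⟩
  ext x
  rw [ZFSet.mem_inter, omega2, mem_toZFSet_iff, mem_toZFSet_iff]
  constructor
  · rintro ⟨hx, i, hi, rfl⟩
    exact ⟨i, (hiff i hi).1 ((mem_ords_elems hM.mem_H).2 hx), rfl⟩
  · rintro ⟨i, hi, rfl⟩
    exact ⟨(mem_ords_elems hM.mem_H).1 ((hiff i (hi.trans hδ)).2 hi), i, hi.trans hδ, rfl⟩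

theorem isOrdinal_inter_omega2 (hM : 𝒞.IsModel M) : (M ∩ omega2).IsOrdinal := by
  obtain ⟨δ, -, h, -⟩ := hM.exists_inter_omega2_eq
  rw [h]; exact ZFSet.isOrdinal_toZFSet δ

theorem inter_mem (hM : 𝒞.IsModel M) (hN : 𝒞.IsModel N) (hlong : 𝒞.IsLong N)
    (h : M ∩ omega2 ∈ N ∩ omega2) : M ∩ N ∈ N := by
  obtain ⟨δ, hδ, hδM, hiff⟩ := hM.exists_inter_omega2_eq
  have hP := hM.inter hN
  have hords : ords (elems (M ∩ N)) = ords (elems M) ∩ ords (elems N) := by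
    rw [elems_inter, ords_inter]
  have hne : (ords (elems M) ∩ ords (elems N)).Nonempty := hords ▸ hP.isRich.nonempty
  have hδN : δ ∈ ords (elems N) := by
    rw [mem_ords_elems hN.mem_H, ← hδM]; exact (ZFSet.mem_inter.1 h).1
  have hα := hM.isRich.sSup_inter_mem 𝒞.square hN.isRich hne
    (fun i hi hi2 => (hiff i hi2).1 hi) hδ hδN hlong
  have hmem := hM.isRich.mem_inter_iff 𝒞.square
    (fun β hβ ξ hξ => ⟨𝒞.fi_lt β ξ, 𝒞.f_fi β hβ ξ hξ⟩) hN.isRich hne hiff hδ hδN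
  set α := sSup (ords (elems M) ∩ ords (elems N))
  have hPH : M ∩ N ∈ H (ℵ_ 3) := by
    refine mem_H_of_forall_mem hP.mem_H ?_
    rw [card_eq_aleph_one_iff.1 hP.card_eq]; exact aleph_one_lt_aleph_two.le
  obtain ⟨wα, hwα, hwα'⟩ := hα
  obtain ⟨wδ, hwδ, hwδ'⟩ := hδN
  -- `N` is closed under the operation which takes `α` and `δ` to `{e (f β i) | β ∈ c α, i < δ}`
  refine hN.closed (fun n => if n = 0 then wα else wδ)
    (fun n => by split_ifs <;> assumption)
    (show (⟨M ∩ N, hPH⟩ : HMem.{u}) ∈ _ from Or.inr (Or.inl fun x => ?_))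
  simp only [if_true, one_ne_zero, if_false, hwα', hwδ', rank_toZFSet]
  constructor
  · intro hx
    have h1 := ei_mem hP.closed (w := ⟨x, hP.mem_H x hx⟩) hx
    rw [hords, hmem] at h1
    obtain ⟨β, hβ, i, hi, h2⟩ := h1
    exact ⟨β, hβ, i, hi, by rw [← h2, 𝒞.e_ei]⟩
  · rintro ⟨β, hβ, i, hi, rfl⟩
    exact e_mem hP.closed (hords ▸ (hmem _).2 ⟨β, hβ, i, hi, rfl⟩)

end IsModel

end Coding

/-! ### Clubs and closure under finitary functions -/

variable {𝒞 : Coding.{u}} {C : Set ZFSet.{u}}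

theorem Coding.small (𝒞 : Coding.{u}) : Small.{u} HMem.{u} :=
  small_of_injective (β := Set.Iio (ω_ 3)) (f := fun w => ⟨𝒞.ei w, 𝒞.ei_lt w⟩) fun w w' h => by
    have h : 𝒞.ei w = 𝒞.ei w' := congrArg Subtype.val h
    rw [← 𝒞.e_ei w, ← 𝒞.e_ei w', h]

theorem Coding.exists_elems_eq (𝒞 : Coding.{u}) (X : Set HMem.{u}) :
    ∃ M : ZFSet.{u}, (∀ x ∈ M, x ∈ H (ℵ_ 3)) ∧ elems M = X := by
  have := 𝒞.small
  refine ⟨ZFSet.range fun w : X => w.1.1, fun x hx => ?_, ?_⟩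
  · obtain ⟨w, rfl⟩ := ZFSet.mem_range.1 hx
    exact w.1.2
  · ext w
    refine ZFSet.mem_range.trans ⟨?_, fun h => ⟨⟨w, h⟩, rfl⟩⟩
    rintro ⟨w', h⟩
    exact Subtype.ext h ▸ w'.2

theorem mk_ofOrds_Iio_omega_one : #(ofOrds (Set.Iio (ω_ (1 : Ordinal.{u})))) = ℵ₁ := by
  have hI : #(Set.Iio (ω_ (1 : Ordinal.{u}))) = ℵ₁ := by
    rw [Cardinal.mk_Iio_ordinal, card_omega, lift_aleph, Ordinal.lift_one]
  refine hI ▸ le_antisymm (mk_ofOrds_le _) ?_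
  conv_lhs => rw [← ords_ofOrds (S := Set.Iio (ω_ 1)) fun i hi =>
    lt_trans hi (omega_one_lt_omega_two.trans omega_two_lt_omega_three)]
  exact mk_ords_le _

theorem mk_eq_of_mem_subsetsOmega1 {M : ZFSet.{u}} (hM : M ∈ subsetsOmega1 (H (ℵ_ 3))) :
    #(elems M) = ℵ₁ := by
  rw [mk_elems hM.1, card_eq_aleph_one_iff.1 hM.2]

theorem mem_subsetsOmega1_of_mk_eq {M : ZFSet.{u}} (hM : ∀ x ∈ M, x ∈ H (ℵ_ 3))
    (h : #(elems M) = ℵ₁) : M ∈ subsetsOmega1 (H (ℵ_ 3)) :=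
  ⟨hM, card_eq_aleph_one_iff.2 ((mk_elems hM).symm.trans h)⟩

theorem IsClubOmega1.exists_subset (hC : IsClubOmega1 (H (ℵ_ 3)) C) (𝒞 : Coding.{u})
    (X : Set HMem.{u}) : ∃ b ∈ C, #X ≤ ℵ₁ → X ⊆ elems b := by
  have key : ∀ X : Set HMem.{u}, #X ≤ ℵ₁ → ∃ b ∈ C, X ⊆ elems b := fun X hX => by
    obtain ⟨M, hM, hMX⟩ := 𝒞.exists_elems_eq (X ∪ ofOrds (Set.Iio (ω_ 1)))
    have hcard : #(elems M) = ℵ₁ := by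
      rw [hMX]
      refine le_antisymm (mk_union_le_aleph_one hX mk_ofOrds_Iio_omega_one.le) ?_
      rw [← mk_ofOrds_Iio_omega_one]
      exact mk_le_mk_of_subset Set.subset_union_right
    obtain ⟨b, hb, hsub⟩ := hC.unbounded M (mem_subsetsOmega1_of_mk_eq hM hcard)
    refine ⟨b, hb, fun w hw => hsub ?_⟩
    have : w ∈ elems M := hMX ▸ Or.inl hw
    exact this
  by_cases hX : #X ≤ ℵ₁
  · obtain ⟨b, hb, h⟩ := key X hX
    exact ⟨b, hb, fun _ => h⟩
  · obtain ⟨b, hb, -⟩ := key ∅ (by simp)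
    exact ⟨b, hb, fun h => absurd h hX⟩

/-- A monotone function from finite sets to the club, by recursion on the finite set. -/
theorem IsClubOmega1.exists_finset_fun (hC : IsClubOmega1 (H (ℵ_ 3)) C) (𝒞 : Coding.{u}) :
    ∃ F : Finset HMem.{u} → ZFSet.{u}, (∀ s, F s ∈ C) ∧ (∀ s : Finset HMem, ↑s ⊆ elems (F s)) ∧
      ∀ s t, s ⊆ t → F s ⊆ F t := by
  classical
  choose g hgC hg using hC.exists_subset 𝒞
  let F : Finset HMem.{u} → ZFSet.{u} := fun s => Finset.strongInduction
    (fun s r => g (↑s ∪ ⋃ t : {t // t ⊂ s}, elems (r t.1 t.2))) s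
  have hF : ∀ s, F s = g (↑s ∪ ⋃ t : {t // t ⊂ s}, elems (F t.1)) := fun s =>
    Finset.strongInduction_eq _ _
  have hFC : ∀ s, F s ∈ C := fun s => by rw [hF]; exact hgC _
  have hsub : ∀ s : Finset HMem.{u}, ↑s ∪ ⋃ t : {t // t ⊂ s}, elems (F t.1) ⊆ elems (F s) := by
    intro s
    conv_rhs => rw [hF]
    have hcount : Countable {t // t ⊂ s} :=
      Set.Finite.countable (s := {t | t ⊂ s})
        (s.powerset.finite_toSet.subset fun t ht => by simpa using ht.1)
    refine hg _ (mk_union_le_aleph_one ?_ (mk_iUnion_le_of_le (aleph0_le_aleph 1) ?_ ?_))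
    · exact (s.finite_toSet.lt_aleph0.le).trans (aleph0_le_aleph 1)
    · exact (mk_le_aleph0_iff.2 hcount).trans (aleph0_le_aleph 1)
    · exact fun t => (mk_eq_of_mem_subsetsOmega1 (hC.subset (hFC _))).le
  refine ⟨F, hFC, fun s => Set.subset_union_left.trans (hsub s), fun s t hst => ?_⟩
  rcases hst.eq_or_ssubset with rfl | hss
  · exact fun _ h => h
  · intro x hx
    exact hsub t (show (⟨x, (hC.subset (hFC s)).1 x hx⟩ : HMem.{u}) ∈ _ from
      Or.inr (Set.mem_iUnion.2 ⟨⟨s, hss⟩, hx⟩))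

theorem exists_monotone_finset {α : Type v} {X : Set α} (hX : X.Countable) :
    ∃ t : ℕ → Finset α, Monotone t ∧ ⋃ n, (t n : Set α) = X := by
  classical
  rcases X.eq_empty_or_nonempty with rfl | hne
  · exact ⟨fun _ => ∅, fun _ _ _ => le_rfl, by simp⟩
  · obtain ⟨x, rfl⟩ := hX.exists_eq_range hne
    refine ⟨fun n => (Finset.range n).image x, fun m n h => ?_, ?_⟩
    · exact Finset.image_subset_image (Finset.range_mono h)
    · ext a
      simp only [Set.mem_iUnion, Finset.coe_image, Finset.coe_range, Set.mem_image, Set.mem_Iio,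
        Set.mem_range]
      exact ⟨fun ⟨_, m, _, h⟩ => ⟨m, h⟩, fun ⟨m, h⟩ => ⟨m + 1, m, m.lt_succ_self, h⟩⟩

theorem mk_zfset_range_le {ι : Type (u + 1)} [Small.{u} ι] (g : ι → ZFSet.{u}) :
    #(ZFSet.range g) ≤ #ι :=
  mk_le_of_surjective (f := fun i => ⟨g i, ZFSet.mem_range_self i⟩) fun ⟨x, hx⟩ => by
    obtain ⟨i, rfl⟩ := ZFSet.mem_range.1 hx
    exact ⟨i, rfl⟩

theorem card_le_aleph_one_of_mk_le {x : ZFSet.{u}} (h : #x ≤ (ℵ₁ : Cardinal.{u + 1})) :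
    x.card ≤ ℵ₁ := by
  have := (card_le_aleph_iff (x := x) (n := 1)).2
  rw [Nat.cast_one, Nat.cast_one] at this
  exact this h

/-- A set of size `ω₁` closed under `F` belongs to the club: it is the union of an `ω₁`-chain of
unions of `F` over the finite subsets of countable sets, and each of these is the union of an
`ω`-chain of values of `F`. -/
theorem IsClubOmega1.mem_of_closed (hC : IsClubOmega1 (H (ℵ_ 3)) C) (𝒞 : Coding.{u})
    {F : Finset HMem.{u} → ZFSet.{u}} (hFC : ∀ s, F s ∈ C)
    (hF : ∀ s : Finset HMem.{u}, ↑s ⊆ elems (F s)) (hmono : ∀ s t, s ⊆ t → F s ⊆ F t)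
    {M : ZFSet.{u}} (hM : M ∈ subsetsOmega1 (H (ℵ_ 3)))
    (hMF : ∀ s : Finset HMem.{u}, ↑s ⊆ elems M → F s ⊆ M) : M ∈ C := by
  have := 𝒞.small
  -- the union of `F` over the finite subsets of `X`
  let U : Set HMem.{u} → ZFSet.{u} := fun X =>
    ZFSet.sep (fun x => ∃ s : Finset HMem.{u}, ↑s ⊆ X ∧ x ∈ F s) M
  have hUmono : ∀ X X', X ⊆ X' → U X ⊆ U X' := fun X X' h x hx => by
    obtain ⟨h1, s, h2, h3⟩ := ZFSet.mem_sep.1 hx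
    exact ZFSet.mem_sep.2 ⟨h1, s, h2.trans h, h3⟩
  have hUC : ∀ X ⊆ elems M, X.Countable → U X ∈ C := fun X hXM hX => by
    obtain ⟨t, ht, rfl⟩ := exists_monotone_finset hX
    have hU : U (⋃ n, (t n : Set HMem.{u})) =
        ZFSet.sUnion (ZFSet.range fun n : ULift.{u + 1} ℕ => F (t n.down)) := by
      ext x
      simp only [U, ZFSet.mem_sep, ZFSet.mem_sUnion, ZFSet.mem_range]
      constructor
      · rintro ⟨-, s, hs, hx⟩
        choose n hn using fun w : s => Set.mem_iUnion.1 (hs w.2)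
        refine ⟨_, ⟨⟨s.attach.sup n⟩, rfl⟩, hmono s _ (fun w hw => ?_) hx⟩
        exact ht (Finset.le_sup (Finset.mem_attach s ⟨w, hw⟩)) (hn ⟨w, hw⟩)
      · rintro ⟨_, ⟨n, rfl⟩, hx⟩
        have hn := Set.subset_iUnion (fun n => (t n : Set HMem.{u})) n.down
        exact ⟨hMF _ (hn.trans hXM) hx, t n.down, hn, hx⟩
    rw [hU]
    refine hC.closed _ ⟨_, ZFSet.mem_range_self ⟨0⟩⟩ (fun a ha => ?_) (fun a ha b hb => ?_) ?_
    · obtain ⟨n, rfl⟩ := ZFSet.mem_range.1 ha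
      exact hFC _
    · obtain ⟨n, rfl⟩ := ZFSet.mem_range.1 ha
      obtain ⟨m, rfl⟩ := ZFSet.mem_range.1 hb
      rcases le_total n.down m.down with h | h
      exacts [Or.inl (hmono _ _ (ht h)), Or.inr (hmono _ _ (ht h))]
    · refine card_le_aleph_one_of_mk_le ((mk_zfset_range_le _).trans ?_)
      simp
  let ι := (ℵ₁ : Cardinal.{u + 1}).ord.ToType
  have hι : #ι = ℵ₁ := by simp [ι]
  obtain ⟨x⟩ : Nonempty (ι ≃ elems M) := by
    rw [← Cardinal.eq, hι, mk_eq_of_mem_subsetsOmega1 hM]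
  have hsmall : Small.{u} ι := small_map x
  let X : ι → Set HMem.{u} := fun i => (fun j => (x j).1) '' Set.Iio i
  have hXM : ∀ i, X i ⊆ elems M := by rintro i _ ⟨j, -, rfl⟩; exact (x j).2
  have hX : ∀ i, (X i).Countable := fun i => by
    refine Set.Countable.image (mk_le_aleph0_iff.1 ?_) _
    rw [← Order.lt_succ_iff, succ_aleph0]
    have := mk_Iio_lt i (by simp [ι])
    rwa [hι] at this
  have hne : Nonempty ι := by rw [← mk_ne_zero_iff, hι]; exact (aleph_pos 1).ne'
  have hMU : M = ZFSet.sUnion (ZFSet.range fun i : ι => U (X i)) := by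
    ext y
    simp only [ZFSet.mem_sUnion, ZFSet.mem_range]
    constructor
    · intro hy
      obtain ⟨j, hj⟩ := x.surjective ⟨⟨y, hM.1 y hy⟩, hy⟩
      obtain ⟨i, hi⟩ := exists_forall_lt_of_mk_lt isRegular_aleph_one {j}
        (by rw [mk_singleton]; exact one_lt_aleph0.trans_le (aleph0_le_aleph 1))
      refine ⟨_, ⟨i, rfl⟩, ZFSet.mem_sep.2 ⟨hy, {(x j).1}, ?_, ?_⟩⟩
      · rw [Finset.coe_singleton, Set.singleton_subset_iff]
        exact ⟨j, hi j rfl, rfl⟩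
      · have h := hF {(x j).1} (by simp : (x j).1 ∈ _)
        rw [hj] at h ⊢
        exact h
    · rintro ⟨_, ⟨i, rfl⟩, hy⟩
      exact (ZFSet.mem_sep.1 hy).1
  rw [hMU]
  refine hC.closed _ ⟨_, ZFSet.mem_range_self hne.some⟩ (fun a ha => ?_) (fun a ha b hb => ?_) ?_
  · obtain ⟨i, rfl⟩ := ZFSet.mem_range.1 ha
    exact hUC _ (hXM i) (hX i)
  · obtain ⟨i, rfl⟩ := ZFSet.mem_range.1 ha
    obtain ⟨j, rfl⟩ := ZFSet.mem_range.1 hb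
    rcases le_total i j with h | h
    exacts [Or.inl (hUmono _ _ (Set.image_mono (Set.Iio_subset_Iio h))),
      Or.inr (hUmono _ _ (Set.image_mono (Set.Iio_subset_Iio h)))]
  · exact card_le_aleph_one_of_mk_le ((mk_zfset_range_le _).trans hι.le)

open Classical in
/-- The members of the values of `F` at the sets of the first `n` terms of a sequence. -/
def finiteOps (F : Finset HMem.{u} → ZFSet.{u}) (s : ℕ → HMem.{u}) : Set HMem.{u} :=
  ⋃ n : ℕ, elems (F ((Finset.range n).image s))

theorem mk_finiteOps_le (hC : IsClubOmega1 (H (ℵ_ 3)) C) {F : Finset HMem.{u} → ZFSet.{u}}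
    (hFC : ∀ s, F s ∈ C) (s : ℕ → HMem.{u}) : #(finiteOps F s) ≤ ℵ₁ := by
  classical
  have := lift_mk_iUnion_le_of_le (c := ℵ₁) (aleph0_le_aleph 1)
    (f := fun n : ℕ => elems (F (((Finset.range n).image s)))) (by simp)
    fun i => by simpa using (mk_eq_of_mem_subsetsOmega1 (hC.subset (hFC _))).le
  simpa [finiteOps] using this

theorem elems_subset_of_closedUnder {F : Finset HMem.{u} → ZFSet.{u}} {X : Set HMem.{u}}
    (hX : ClosedUnder (finiteOps F) X) (hne : X.Nonempty) (t : Finset HMem.{u}) (ht : ↑t ⊆ X) :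
    elems (F t) ⊆ X := by
  classical
  obtain ⟨w₀, hw₀⟩ := hne
  let s : ℕ → HMem.{u} := fun n => if h : n < t.card then (t.equivFin.symm ⟨n, h⟩).1 else w₀
  have hs : (Finset.range t.card).image s = t := by
    ext w
    simp only [Finset.mem_image, Finset.mem_range]
    constructor
    · rintro ⟨n, hn, rfl⟩
      simp only [s, dif_pos hn]
      exact (t.equivFin.symm ⟨n, hn⟩).2
    · intro hw
      refine ⟨(t.equivFin ⟨w, hw⟩).1, (t.equivFin ⟨w, hw⟩).2, ?_⟩
      simp [s]
  have hsX : ∀ n, s n ∈ X := fun n => by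
    simp only [s]; split_ifs; exacts [ht (t.equivFin.symm _).2, hw₀]
  refine Set.Subset.trans ?_ (hX s hsX)
  intro w hw
  refine Set.mem_iUnion.2 ⟨t.card, ?_⟩
  convert hw

/-! ### Stationarity -/

theorem mk_iUnion_ops_le {c : Cardinal.{u + 1}} (hc : ℵ₁ ≤ c)
    (hpow : c ^ (ℵ₀ : Cardinal.{u + 1}) ≤ c) {Ω : (ℕ → HMem.{u}) → Set HMem.{u}}
    (hΩ : ∀ s, #(Ω s) ≤ ℵ₁) (Z : Set HMem.{u}) (hZ : #Z ≤ c) :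
    #(⋃ s : ℕ → Z, Ω fun n => s n : Set HMem.{u}) ≤ c :=
  mk_iUnion_le_of_le ((aleph0_le_aleph 1).trans hc) (mk_nat_fun_le hpow Z hZ)
    fun _ => (hΩ _).trans hc

/-- There is a closed set whose ordinals form an ordinal `δ < ω₃` of cofinality greater than `ω₁`.
It is built in `ω₂` stages of size at most `ω₂`. Each stage adds the ordinals up to a strict upper
bound of those present, so that any `ω₁` many ordinals below `δ` are bounded below `δ`. -/
theorem exists_closedUnder_ords_eq_Iio
    (hCH : (2 : Cardinal.{u + 1}) ^ (ℵ₀ : Cardinal.{u + 1}) = ℵ₁)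
    {Ω : (ℕ → HMem.{u}) → Set HMem.{u}} (hΩ : ∀ s, #(Ω s) ≤ ℵ₁) (w₀ : HMem.{u}) :
    ∃ K : Set HMem.{u}, w₀ ∈ K ∧ ClosedUnder Ω K ∧ ∃ δ < ω_ 3, Order.IsSuccLimit δ ∧
      ords K = Set.Iio δ ∧ ∀ A ⊆ Set.Iio δ, #A ≤ ℵ₁ → ∃ γ < δ, ∀ a ∈ A, a < γ := by
  have h12 := aleph_one_lt_aleph_two.{u + 1}
  let top : Set HMem.{u} → Ordinal.{u} := fun Z => Order.succ (sSup (ords Z))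
  let step : Set HMem.{u} → Set HMem.{u} := fun Z =>
    ({w₀} ∪ ⋃ s : ℕ → Z, Ω fun n => s n) ∪ ofOrds (Set.Iio (Order.succ (top Z)))
  have htop : ∀ Z : Set HMem.{u}, #Z ≤ ℵ_ 2 → top Z < ω_ 3 := fun Z hZ =>
    (isSuccLimit_omega 3).succ_lt
      (sSup_lt_omega_three (fun _ => lt_of_mem_ords) ((mk_ords_le Z).trans hZ))
  have hstep : ∀ Z : Set HMem.{u}, #Z ≤ ℵ_ 2 → #(step Z) ≤ ℵ_ 2 := fun Z hZ => by
    refine (mk_union_le _ _).trans (add_le_of_le (aleph0_le_aleph 2) ((mk_union_le _ _).trans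
      (add_le_of_le (aleph0_le_aleph 2) ?_ ?_)) ?_)
    · rw [mk_singleton]; exact one_le_aleph0.trans (aleph0_le_aleph 2)
    · exact mk_iUnion_ops_le h12.le (aleph_two_power_aleph0 hCH) hΩ Z hZ
    · exact (mk_ofOrds_le _).trans
        (mk_Iio_le_aleph_two ((isSuccLimit_omega 3).succ_lt (htop Z hZ)))
  obtain ⟨K, hK, hKstep⟩ := exists_closed isRegular_aleph_two step hstep
  have hmem : ∀ Z, step Z ⊆ K → #Z ≤ ℵ_ 2 → ∀ α ≤ top Z, α ∈ ords K := fun Z hZ hZ2 α hα =>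
    (mem_ords_iff (hα.trans_lt (htop Z hZ2))).2 (hZ (Or.inr ⟨α, Order.lt_succ_iff.2 hα, rfl⟩))
  have hle : ∀ {Z : Set HMem.{u}} {α : Ordinal.{u}}, α ∈ ords Z → α < top Z := fun {Z α} h =>
    Order.lt_succ_iff.2 (le_csSup ⟨ω_ 3, fun _ h => (lt_of_mem_ords h).le⟩ h)
  have hsingle : ∀ α ∈ ords K, ∀ β ≤ Order.succ α, β ∈ ords K := by
    rintro α ⟨w, hw, hwα⟩ β hβ
    obtain ⟨Z, hwZ, -, hZ2, hZ⟩ := hKstep {w} (Set.singleton_subset_iff.2 hw)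
      (by rw [mk_singleton]; exact one_lt_aleph0.trans_le (aleph0_le_aleph 2))
    refine hmem Z hZ hZ2 β (hβ.trans (Order.succ_le_of_lt (hle ⟨w, hwZ rfl, hwα⟩)))
  have hsup : IsStrictSup (ords K) (sSup (ords K)) :=
    isStrictSup_sSup (fun _ => lt_of_mem_ords) fun α hα => hsingle α hα _ le_rfl
  have hne : (ords K).Nonempty := by
    obtain ⟨Z, -, -, hZ2, hZ⟩ := hKstep ∅ (Set.empty_subset _)
      (by rw [mk_eq_zero]; exact aleph_pos 2)
    exact ⟨0, hmem Z hZ hZ2 0 zero_le⟩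
  have hIio : ords K = Set.Iio (sSup (ords K)) := by
    ext α
    refine ⟨hsup.lt α, fun hα => ?_⟩
    obtain ⟨a, ha, hlt⟩ := hsup.exists_lt α hα
    exact hsingle a ha α (hlt.le.trans (Order.le_succ a))
  refine ⟨K, ?_, fun s hs => ?_, sSup (ords K), ?_, hsup.isSuccLimit hne, hIio,
    fun A hA hA1 => ?_⟩
  · obtain ⟨Z, -, -, -, hZ⟩ := hKstep ∅ (Set.empty_subset _)
      (by rw [mk_eq_zero]; exact aleph_pos 2)
    exact hZ (Or.inl (Or.inl rfl))
  · obtain ⟨Z, hsZ, -, -, hZ⟩ := hKstep (Set.range s) (by rintro _ ⟨n, rfl⟩; exact hs n)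
      ((mk_le_aleph0_iff.2 (Set.countable_range s)).trans_lt ((aleph0_le_aleph 1).trans_lt h12))
    refine Set.Subset.trans (fun w hw => ?_) hZ
    exact Or.inl (Or.inr (Set.mem_iUnion.2 ⟨fun n => ⟨s n, hsZ ⟨n, rfl⟩⟩, hw⟩))
  · exact sSup_lt_omega_three (fun _ => lt_of_mem_ords) ((mk_ords_le K).trans hK)
  · rw [← hIio] at hA
    choose g hg hg' using fun a : A => hA a.2
    obtain ⟨Z, hgZ, -, hZ2, hZ⟩ := hKstep (Set.range g) (by rintro _ ⟨a, rfl⟩; exact hg a)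
      (mk_range_le.trans_lt (hA1.trans_lt h12))
    refine ⟨top Z, hsup.lt _ (hmem Z hZ hZ2 _ le_rfl), fun a ha => ?_⟩
    exact hle ⟨g ⟨a, ha⟩, hgZ ⟨_, rfl⟩, hg' _⟩

/-- A closed set contains a closed set of size at most `ω₁`. -/
theorem ClosedUnder.exists_mk_le (hCH : (2 : Cardinal.{u + 1}) ^ (ℵ₀ : Cardinal.{u + 1}) = ℵ₁)
    {Ω : (ℕ → HMem.{u}) → Set HMem.{u}} (hΩ : ∀ s, #(Ω s) ≤ ℵ₁) {K : Set HMem.{u}}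
    (hK : ClosedUnder Ω K) {w₀ : HMem.{u}} (hw₀ : w₀ ∈ K) :
    ∃ N ⊆ K, #N ≤ ℵ₁ ∧ w₀ ∈ N ∧ ClosedUnder Ω N := by
  let step : Set HMem.{u} → Set HMem.{u} := fun Z => {w₀} ∪ ⋃ s : ℕ → Z, Ω fun n => s n
  obtain ⟨N, hN, hNstep⟩ := exists_closed isRegular_aleph_one (fun Z => step Z ∩ K) fun Z hZ =>
    (mk_le_mk_of_subset Set.inter_subset_left).trans (mk_union_le_aleph_one
      (by rw [mk_singleton]; exact one_le_aleph0.trans (aleph0_le_aleph 1))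
      (mk_iUnion_ops_le le_rfl (aleph_one_power_aleph0 hCH).le hΩ Z hZ))
  refine ⟨N ∩ K, Set.inter_subset_right, (mk_le_mk_of_subset Set.inter_subset_left).trans hN,
    ⟨?_, hw₀⟩, fun s hs => Set.subset_inter ?_ (hK s fun n => (hs n).2)⟩
  · obtain ⟨Z, -, -, -, hZ⟩ := hNstep ∅ (Set.empty_subset _)
      (by rw [mk_eq_zero]; exact aleph_pos 1)
    exact hZ ⟨Or.inl rfl, hw₀⟩
  · obtain ⟨Z, hsZ, -, -, hZ⟩ := hNstep (Set.range s) (by rintro _ ⟨n, rfl⟩; exact (hs n).1)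
      ((mk_le_aleph0_iff.2 (Set.countable_range s)).trans_lt
        (by rw [← succ_aleph0]; exact Order.lt_succ _))
    refine Set.Subset.trans (fun w hw => ?_) hZ
    exact ⟨Or.inr (Set.mem_iUnion.2 ⟨fun n => ⟨s n, hsZ ⟨n, rfl⟩⟩, hw⟩),
      hK s (fun n => (hs n).2) hw⟩

/-- The element of `D` whose index is given by the first term of a sequence, and the next element of
`D` above this term. -/
def nthNextOps (D : Set Ordinal.{u}) (s : ℕ → HMem.{u}) : Set HMem.{u} :=
  ofOrds ({η | η ∈ D ∧ index D η = (s 0).1.rank} ∪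
    {η | η ∈ D ∧ (s 0).1.rank < η ∧ ∀ η' ∈ D, (s 0).1.rank < η' → η ≤ η'})

theorem mk_nthNextOps_le (D : Set Ordinal.{u}) (s : ℕ → HMem.{u}) : #(nthNextOps D s) ≤ ℵ₁ := by
  refine (mk_ofOrds_le _).trans (mk_union_le_aleph_one ?_ ?_)
  · exact mk_le_aleph_one_of_subsingleton fun a ha b hb =>
      index_injOn D ha.1 hb.1 (ha.2.trans hb.2.symm)
  · exact mk_le_aleph_one_of_subsingleton fun a ha b hb =>
      (ha.2.2 b hb.1 hb.2.1).antisymm (hb.2.2 a ha.1 ha.2.1)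

/-- If every subset of `δ` of size at most `ω₁` is bounded, then `c δ` has order type
at least `ω₂`: otherwise `c δ` itself has size at most `ω₁`. -/
theorem exists_index_eq_of_lt_omega_two {c : Ordinal.{u} → Set Ordinal.{u}} (hc : IsSquareSeq c)
    {δ : Ordinal.{u}} (hδ : δ < ω_ 3) (hl : Order.IsSuccLimit δ)
    (hcof : ∀ A ⊆ Set.Iio δ, #A ≤ ℵ₁ → ∃ γ < δ, ∀ a ∈ A, a < γ) {i : Ordinal.{u}} (hi : i < ω_ 2) :
    ∃ η ∈ c δ, index (c δ) η = i := by
  by_contra! hno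
  have hlt : ∀ η ∈ c δ, index (c δ) η < i := fun η hη => by
    by_contra! hle
    obtain ⟨ζ, hζ, -, h⟩ := exists_index_eq (hle.lt_of_ne (hno η hη).symm)
    exact hno ζ hζ h
  have hcard : #(c δ) ≤ ℵ₁ := by
    have h1 : #(c δ) ≤ #(Set.Iio i) :=
      mk_le_of_injective (f := fun η => ⟨index (c δ) η, hlt η η.2⟩) fun η ζ h =>
        Subtype.ext (index_injOn _ η.2 ζ.2 (congrArg Subtype.val h))
    exact h1.trans (mk_Iio_le_aleph_one hi)
  obtain ⟨γ, hγ, hlt⟩ := hcof (c δ) (hc.lt δ hδ hl) hcard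
  obtain ⟨ξ, hξ, hγξ⟩ := hc.unbounded δ hδ hl γ hγ
  exact (hlt ξ hξ).not_gt hγξ

/-- The model is a closed subset of size `ω₁` of the set `K` with `K ∩ ω₃ = δ` given by
`exists_closedUnder_ords_eq_Iio`. As `K` contains `δ`, it is closed under the additional operations
obtained from `c δ`. -/
theorem exists_isModel_isLong_mem
    (hCH : (2 : Cardinal.{u + 1}) ^ (ℵ₀ : Cardinal.{u + 1}) = ℵ₁)
    (hC : IsClubOmega1 (H (ℵ_ 3)) C) :
    ∃ N, 𝒞.IsModel N ∧ 𝒞.IsLong N ∧ N ∈ C := by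
  obtain ⟨F, hFC, hFs, hFmono⟩ := hC.exists_finset_fun 𝒞
  let w₀ : HMem.{u} := ⟨(ω_ 1).toZFSet, toZFSet_mem_H_iff.2
    (omega_one_lt_omega_two.trans omega_two_lt_omega_three)⟩
  obtain ⟨K, hw₀K, hK, δ, hδ, hl, hKδ, hcof⟩ := exists_closedUnder_ords_eq_Iio hCH
    (Ω := fun s => 𝒞.ops s ∪ finiteOps F s)
    (fun s => mk_union_le_aleph_one (𝒞.mk_ops_le s) (mk_finiteOps_le hC hFC s)) w₀
  have hc := 𝒞.square
  have hKc : ClosedUnder (nthNextOps (𝒞.c δ)) K := by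
    refine fun s _ => ofOrds_subset fun η hη => hKδ ▸ ?_
    rcases hη with hη | hη <;> exact hc.lt δ hδ hl η hη.1
  obtain ⟨X, hXK, hX1, hw₀X, hX⟩ := ClosedUnder.exists_mk_le hCH
    (Ω := fun s => (𝒞.ops s ∪ finiteOps F s) ∪ nthNextOps (𝒞.c δ) s)
    (fun s => mk_union_le_aleph_one (mk_union_le_aleph_one (𝒞.mk_ops_le s)
      (mk_finiteOps_le hC hFC s)) (mk_nthNextOps_le _ s))
    (fun s hs => Set.union_subset (hK s hs) (hKc s hs)) hw₀K
  obtain ⟨N, hNH, rfl⟩ := 𝒞.exists_elems_eq X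
  have hXops : ClosedUnder 𝒞.ops (elems N) := fun s hs =>
    (Set.subset_union_left.trans Set.subset_union_left).trans (hX s hs)
  have hXF : ClosedUnder (finiteOps F) (elems N) := fun s hs =>
    (Set.subset_union_right.trans Set.subset_union_left).trans (hX s hs)
  have hXc : ClosedUnder (nthNextOps (𝒞.c δ)) (elems N) := fun s hs =>
    Set.subset_union_right.trans (hX s hs)
  have hω : ω_ 1 ∈ ords (elems N) := ⟨w₀, hw₀X, rfl⟩
  have hrich := Coding.isRich hXops hX1 ⟨_, hω⟩
  have hcard : #(elems N) = ℵ₁ := by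
    refine hX1.antisymm ?_
    rw [← mk_ofOrds_Iio_omega_one]
    exact mk_le_mk_of_subset (ofOrds_subset (hrich.down_mem _ hω omega_one_lt_omega_two))
  have hN := mem_subsetsOmega1_of_mk_eq hNH hcard
  have hModel : 𝒞.IsModel N := ⟨hNH, hN.2, hw₀X, hXops⟩
  refine ⟨N, hModel, fun i hi hi2 => ?_, hC.mem_of_closed 𝒞 hFC hFs hFmono hN fun s hs x hx => ?_⟩
  · have hα := hrich.isStrictSup
    have hsub : ords (elems N) ⊆ Set.Iio δ := by
      rw [← hKδ]; rintro a ⟨w, hw, h⟩; exact ⟨w, hXK hw, h⟩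
    obtain ⟨γ, hγ, hγ'⟩ := hcof _ hsub hrich.mk_le
    have hαδ : sSup (ords (elems N)) < δ := (csSup_le' fun a ha => (hγ' a ha).le).trans_lt hγ
    have hnth : ∀ i ∈ ords (elems N), ∀ η ∈ 𝒞.c δ, index (𝒞.c δ) η = i → η ∈ ords (elems N) := by
      rintro i ⟨w, hw, hwi⟩ η hη h
      rw [mem_ords_iff ((hc.lt δ hδ hl η hη).trans hδ)]
      refine hXc (fun _ => w) (fun _ => hw) ⟨η, Or.inl ⟨hη, ?_⟩, rfl⟩
      rw [hwi, rank_toZFSet, h]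
    have hnext : ∀ a ∈ ords (elems N), ∀ η ∈ 𝒞.c δ, a < η → (∀ η' ∈ 𝒞.c δ, a < η' → η ≤ η') →
        η ∈ ords (elems N) := by
      rintro a ⟨w, hw, hwa⟩ η hη h h'
      rw [mem_ords_iff ((hc.lt δ hδ hl η hη).trans hδ)]
      refine hXc (fun _ => w) (fun _ => hw) ⟨η, Or.inr ⟨hη, ?_⟩, rfl⟩
      rw [hwa, rank_toZFSet]
      exact ⟨h, h'⟩
    -- by coherence, `c (sup (N ∩ ω₃))` is an initial segment of `c δ`
    have hlim : IsLimitPoint (sSup (ords (elems N))) (𝒞.c δ) := by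
      refine ⟨hrich.isSuccLimit_sSup.bot_lt, fun γ hγ => ?_⟩
      obtain ⟨a, ha, hγa⟩ := hα.exists_lt γ hγ
      obtain ⟨η, hη, haη, hmin⟩ := exists_next (hc.unbounded δ hδ hl a (hsub ha))
      exact ⟨η, hη, hγa.trans haη, hα.lt η (hnext a ha η hη haη hmin)⟩
    have hcoh := hc.coherent δ hδ hl _ hαδ hlim
    obtain ⟨η, hη, hηi⟩ := exists_index_eq_of_lt_omega_two hc hδ hl hcof hi2
    have hηα := hα.lt η (hnth i hi η hη hηi)
    refine ⟨η, (hcoh η).2 ⟨hη, hηα⟩, ?_⟩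
    rw [← hηi]
    exact index_congr fun ζ hζ => (hcoh ζ).trans (and_iff_left (hζ.trans hηα))
  · exact elems_subset_of_closedUnder hXF ⟨w₀, hw₀X⟩ s hs
      (show (⟨x, (hC.subset (hFC s)).1 x hx⟩ : HMem.{u}) ∈ _ from hx)

theorem isStationaryOmega1_isModel_isLong
    (hCH : (2 : Cardinal.{u + 1}) ^ (ℵ₀ : Cardinal.{u + 1}) = ℵ₁) :
    IsStationaryOmega1 (H (ℵ_ 3)) {N | 𝒞.IsModel N ∧ 𝒞.IsLong N} :=
  ⟨fun _ hN => hN.1.mem_subsetsOmega1, fun _ hC =>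
    let ⟨N, h1, h2, h3⟩ := exists_isModel_isLong_mem hCH hC
    ⟨N, ⟨h1, h2⟩, h3⟩⟩

end MitchellModels

open MitchellModels
theorem mainTheorem4
    (hCH : (2 : Cardinal.{u}) ^ (ℵ₀ : Cardinal.{u}) = ℵ₁)
    (hpow : (2 : Cardinal.{u}) ^ (ℵ_ 2 : Cardinal.{u}) = ℵ_ 3)
    (hsq : SquareOmega2.{u}) :
    ∃ Y Yp : Set ZFSet.{u},
      IsStationaryOmega1 (H (ℵ_ 3)) Y ∧
      IsStationaryOmega1 (H (ℵ_ 3)) Yp ∧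
      (∀ M ∈ Y, IsElementaryIn M (H (ℵ_ 3)) ∧ M.card = ℵ₁ ∧ IsOmegaClosed M) ∧
      (∀ M ∈ Y, ∀ N ∈ Y, M ∩ N ∈ Y) ∧
      Yp ⊆ Y ∧
      (∀ M ∈ Y, (M ∩ omega2).IsOrdinal) ∧
      (∀ M ∈ Y, ∀ N ∈ Yp, M ∩ omega2 ∈ N ∩ omega2 → M ∩ N ∈ N) := by
  have hCH' : (2 : Cardinal.{u + 1}) ^ (ℵ₀ : Cardinal.{u + 1}) = ℵ₁ := by
    simpa using congrArg Cardinal.lift.{u + 1} hCH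
  have hpow' : (2 : Cardinal.{u + 1}) ^ (ℵ_ 2 : Cardinal.{u + 1}) = ℵ_ 3 := by
    simpa using congrArg Cardinal.lift.{u + 1} hpow
  obtain ⟨𝒞⟩ := exists_coding hpow' hsq
  have hst := isStationaryOmega1_isModel_isLong (𝒞 := 𝒞) hCH'
  refine ⟨{M | 𝒞.IsModel M}, {N | 𝒞.IsModel N ∧ 𝒞.IsLong N},
    ⟨fun _ hM => hM.mem_subsetsOmega1, fun C hC => ?_⟩, hst,
    fun M hM => ⟨hM.isElementaryIn, hM.card_eq, hM.isOmegaClosed⟩,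
    fun M hM N hN => hM.inter hN, fun _ hN => hN.1, fun M hM => hM.isOrdinal_inter_omega2,
    fun M hM N hN h => hM.inter_mem hN.1 hN.2 h⟩
  obtain ⟨N, hN, hNC⟩ := hst.2 C hC
  exact ⟨N, hN.1, hNC⟩
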